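/- For every constant $\alpha>1/2$ there is a constant $K=K(\alpha)>0$ such that the following holds. For every $\varepsilon>0$ there is $N$ such that for all integers $n\ge N$, every graph $G$ on $n$ vertices with minimum degree at least $\alpha n$, and every integer $m$ with $K n^{4/3}(\log n)^{1/3}\le m\le\binom n2$: if $X$ is chosen uniformly at random among all sets of exactly $m$ edges of the complete graph on $V(G)$, then with probability at least $1-\varepsilon$ the graph $G+X=(V(G),E(G)\cup X)$ contains the square of a Hamilton cycle, that is, its vertices can be arranged in a cyclic order $v_1,\dots,v_n$ such that $v_iv_{i+1}$ and $v_iv_{i+2}$ are edges of $G+X$ for every $i$ (indices modulo $n$). -/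

import Mathlib

/-- The graph `G + X` on the vertex set of `G`, with edge set `E(G) ∪ X`. -/
def SimpleGraph.addEdges {V : Type*} (G : SimpleGraph V) (X : Finset (Sym2 V)) :
    SimpleGraph V :=
  G ⊔ SimpleGraph.fromEdgeSet (X : Set (Sym2 V))

/-- A graph on `n` labelled vertices contains the square of a Hamilton cycle: its vertices can be
placed in a cyclic order `π` so that each vertex is adjacent to the next one and to the one after
that. Here `finRotate n` is the cyclic successor `i ↦ i + 1 (mod n)`. -/
def SimpleGraph.ContainsHamiltonCycleSquare {n : ℕ} (H : SimpleGraph (Fin n)) : Prop :=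
  ∃ π : Equiv.Perm (Fin n), ∀ i : Fin n,
    H.Adj (π i) (π (finRotate n i)) ∧ H.Adj (π i) (π (finRotate n (finRotate n i)))

/-- The sets of exactly `m` edges of the complete graph on `n` labelled vertices. -/
def edgeSetsOfSize (n m : ℕ) : Finset (Finset (Sym2 (Fin n))) :=
  Finset.powersetCard m (⊤ : SimpleGraph (Fin n)).edgeFinset

open Classical in
/-- The probability that `X` satisfies `P`, where `X` is a uniformly random set of `m` edges of the
complete graph on `n` labelled vertices (meaningful for `m ≤ n.choose 2`). -/
noncomputable def probRandomEdges (n m : ℕ) (P : Finset (Sym2 (Fin n)) → Prop) : ℝ :=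
  (((edgeSetsOfSize n m).filter P).card : ℝ) / ((edgeSetsOfSize n m).card : ℝ)

/-! ### Random edges: hitting all large families of popular pairs. -/

section
open Finset

/-! Randomness enters only through `HitsPopularPairs`. There are at most `8 ^ n * (n + 1)` families
`popularPairs G S B₁ B₂ θ`, and one with at least `c * n ^ 2` pairs is missed by `X` with
probability at most `exp (-c * m)`. A union bound therefore needs only linearly many random edges,
and the assumed `m` exceeds any fixed multiple of `n` once `n` is large, so `K = 1` works. The rest
is deterministic.

Write the minimum degree as at least `(1/2 + γ) n`; any two vertices then have at least `2γn` common
neighbours. A squared path can be built from consecutive pairs `a a' b b' …` in which `aa'`, `bb'`,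
… are edges of `X` and all other adjacencies come from `G`. Double counting shows that many pairs
have large common neighbourhoods where needed, so `X` contains such a pair, and the next edge of `X`
is sought inside its common neighbourhood. This gives a five-vertex squared path around any vertex
`w` that survives deletion of `w` (`exists_insertion`) and a six-vertex link between any two edges
(`exists_connector`).

Absorption works by deletion. A small reservoir `D` keeps linear codegrees (`exists_reservoir`), and
a short squared path `P` contains `D` so that any part of `D` can be dropped from it
(`exists_absorbing_path`). Outside `P`, Szemerédi's lemma and a maximum matching of the reduced
graph give boundedly many regular pairs, each nearly covered by one squared path
(`exists_squaredPath_cover`). The few leftover vertices are inserted and everything is linked into a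
cycle using vertices of `D` only. The vertices so used are then deleted from `P`, while the unused
ones already lie on it (`containsHamiltonCycleSquare_of_absorbing_path`). -/

/-- The vertices of `B` adjacent to both `x` and `y`. -/
def commonNbrs {V : Type*} (G : SimpleGraph V) [DecidableRel G.Adj] (x y : V) (B : Finset V) :
    Finset V :=
  B.filter fun z => G.Adj x z ∧ G.Adj y z

/-- The ordered pairs of distinct vertices of `S` with at least `θ` common neighbours in each of
`B₁` and `B₂`. -/
def popularPairs {V : Type*} [DecidableEq V] (G : SimpleGraph V) [DecidableRel G.Adj]
    (S B₁ B₂ : Finset V) (θ : ℕ) : Finset (V × V) :=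
  (S ×ˢ S).filter fun p =>
    p.1 ≠ p.2 ∧ θ ≤ #(commonNbrs G p.1 p.2 B₁) ∧ θ ≤ #(commonNbrs G p.1 p.2 B₂)

/-- Every set of popular pairs of size at least `f` contains an edge of `X`. -/
def HitsPopularPairs {V : Type*} [DecidableEq V] (G : SimpleGraph V) [DecidableRel G.Adj]
    (X : Finset (Sym2 V)) (f : ℝ) : Prop :=
  ∀ (S B₁ B₂ : Finset V) (θ : ℕ), f ≤ #(popularPairs G S B₁ B₂ θ) →
    ∃ p ∈ popularPairs G S B₁ B₂ θ, s(p.1, p.2) ∈ X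

lemma card_le_two_mul_card_image_sym2 {V : Type*} [DecidableEq V] (P : Finset (V × V)) :
    #P ≤ 2 * #(P.image fun p => s(p.1, p.2)) := by
  refine card_le_mul_card_image P 2 ?_
  intro e _
  induction e with
  | _ a b =>
    refine (card_le_card (t := {(a, b), (b, a)}) ?_).trans card_le_two
    rintro ⟨x, y⟩ h
    simp only [mem_filter, Sym2.eq_iff] at h
    rcases h.2 with ⟨rfl, rfl⟩ | ⟨rfl, rfl⟩ <;> simp

/-- This is `C(N-s, m) / C(N, m) ≤ (1 - s/N) ^ m` without denominators: each factor `(N-s-k)/(N-k)`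
of the quotient is at most `(N-s)/N`. -/
lemma choose_sub_mul_pow_le (N s m : ℕ) (hs : s ≤ N) :
    ((N - s).choose m : ℝ) * (N : ℝ) ^ m ≤ (N.choose m : ℝ) * ((N : ℝ) - s) ^ m := by
  have key : ∀ m : ℕ, (N - s).descFactorial m * N ^ m ≤ N.descFactorial m * (N - s) ^ m := by
    intro m
    induction m with
    | zero => simp
    | succ k ih =>
      rw [Nat.descFactorial_succ, Nat.descFactorial_succ, pow_succ, pow_succ]
      have h : (N - s - k) * N ≤ (N - k) * (N - s) := by
        by_cases hk : N - s ≤ k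
        · rw [Nat.sub_eq_zero_of_le hk]; simp
        · push Not at hk
          obtain ⟨r, rfl⟩ : ∃ r, N = s + k + r := ⟨N - s - k, by omega⟩
          have h1 : s + k + r - s - k = r := by omega
          have h2 : s + k + r - k = s + r := by omega
          have h3 : s + k + r - s = k + r := by omega
          rw [h1, h2, h3]
          nlinarith [Nat.zero_le (s * k)]
      calc (N - s - k) * (N - s).descFactorial k * (N ^ k * N)
          = ((N - s).descFactorial k * N ^ k) * ((N - s - k) * N) := by ring
        _ ≤ (N.descFactorial k * (N - s) ^ k) * ((N - k) * (N - s)) := Nat.mul_le_mul ih h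
        _ = _ := by ring
  have h := key m
  rw [Nat.descFactorial_eq_factorial_mul_choose, Nat.descFactorial_eq_factorial_mul_choose,
    mul_assoc, mul_assoc] at h
  have h := Nat.le_of_mul_le_mul_left h (Nat.factorial_pos m)
  have h' : (((N - s).choose m * N ^ m : ℕ) : ℝ) ≤ ((N.choose m * (N - s) ^ m : ℕ) : ℝ) := by
    exact_mod_cast h
  push_cast [Nat.cast_sub hs] at h'
  exact h'

lemma card_powersetCard_disjoint_le {β : Type*} [DecidableEq β] (E F : Finset β) (hF : F ⊆ E)
    (hE : E.Nonempty) (m : ℕ) :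
    (#((powersetCard m E).filter fun X => Disjoint X F) : ℝ) ≤
      Real.exp (-(#F * m / #E)) * #(powersetCard m E) := by
  have h1 : (powersetCard m E).filter (fun X => Disjoint X F) = powersetCard m (E \ F) := by
    ext X
    simp only [mem_filter, mem_powersetCard, subset_sdiff]
    tauto
  rw [h1, card_powersetCard, card_powersetCard, card_sdiff_of_subset hF]
  have hs := card_le_card hF
  have hN : (0 : ℝ) < #E := by exact_mod_cast hE.card_pos
  have h2 := choose_sub_mul_pow_le #E #F m hs
  have h3 : ((#E : ℝ) - #F) ^ m ≤ Real.exp (-(#F * m / #E)) * (#E : ℝ) ^ m := by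
    have h4 : ((#E : ℝ) - #F) ≤ Real.exp (-(#F / #E)) * #E := by
      have := Real.add_one_le_exp (-((#F : ℝ) / #E))
      calc ((#E : ℝ) - #F) = (-((#F : ℝ) / #E) + 1) * #E := by field_simp; ring
        _ ≤ _ := by gcongr
    have h5 : (0 : ℝ) ≤ (#E : ℝ) - #F := by
      have : (#F : ℝ) ≤ #E := by exact_mod_cast hs
      linarith
    calc ((#E : ℝ) - #F) ^ m ≤ (Real.exp (-(#F / #E)) * #E) ^ m := by gcongr
      _ = _ := by
        rw [mul_pow, ← Real.exp_nat_mul]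
        congr 2; ring
  have h6 : (0 : ℝ) < (#E : ℝ) ^ m := by positivity
  refine le_of_mul_le_mul_right (h2.trans ?_) h6
  calc _ ≤ ((#E).choose m : ℝ) * (Real.exp (-(#F * m / #E)) * (#E : ℝ) ^ m) := by gcongr
    _ = _ := by ring

/-- Union bound over three vertex sets and a threshold, hence the factor `(2 ^ n) ^ 3 * (n + 1)`. -/
lemma card_filter_not_hitsPopularPairs_le {n : ℕ} (hn : 2 ≤ n) (G : SimpleGraph (Fin n))
    [DecidableRel G.Adj] {c : ℝ} (hc : 0 < c) (m : ℕ)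
    [DecidablePred fun X => ¬ HitsPopularPairs G X (c * (n : ℝ) ^ 2)] :
    (#((edgeSetsOfSize n m).filter fun X => ¬ HitsPopularPairs G X (c * (n : ℝ) ^ 2)) : ℝ) ≤
      (8 : ℝ) ^ n * (n + 1) * Real.exp (-(c * m)) * #(edgeSetsOfSize n m) := by
  classical
  set E := (⊤ : SimpleGraph (Fin n)).edgeFinset with hE
  have hEcard : #E = n.choose 2 := by
    rw [hE]
    have := SimpleGraph.card_edgeFinset_top_eq_card_choose_two (V := Fin n)
    rw [Fintype.card_fin] at this
    convert this
  have hEpos : 0 < #E := by rw [hEcard]; exact Nat.choose_pos hn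
  have hEle : (#E : ℝ) ≤ (n : ℝ) ^ 2 / 2 := by
    rw [hEcard, Nat.cast_choose_two]
    nlinarith [(Nat.cast_nonneg n : (0 : ℝ) ≤ n)]
  let I : Finset ((Finset (Fin n) × Finset (Fin n) × Finset (Fin n)) × ℕ) :=
    (univ ×ˢ range (n + 1)).filter
      fun t => c * (n : ℝ) ^ 2 ≤ #(popularPairs G t.1.1 t.1.2.1 t.1.2.2 t.2)
  let F : (Finset (Fin n) × Finset (Fin n) × Finset (Fin n)) × ℕ → Finset (Sym2 (Fin n)) :=
    fun t => (popularPairs G t.1.1 t.1.2.1 t.1.2.2 t.2).image fun p => s(p.1, p.2)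
  have hsub : (edgeSetsOfSize n m).filter (fun X => ¬ HitsPopularPairs G X (c * (n : ℝ) ^ 2)) ⊆
      I.biUnion fun t => (powersetCard m E).filter fun X => Disjoint X (F t) := by
    intro X hX
    rw [mem_filter] at hX
    obtain ⟨hX1, hX2⟩ := hX
    unfold HitsPopularPairs at hX2
    push Not at hX2
    obtain ⟨S, B₁, B₂, θ, hf, hno⟩ := hX2
    rw [mem_biUnion]
    refine ⟨((S, B₁, B₂), θ), ?_, ?_⟩
    · simp only [I, mem_filter, mem_product, mem_univ, true_and, mem_range]
      refine ⟨?_, hf⟩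
      -- Only thresholds `θ ≤ n` matter: a nonempty family has a pair with at least `θ` common
      -- neighbours.
      have hpos : 0 < #(popularPairs G S B₁ B₂ θ) := by
        have : (0 : ℝ) < #(popularPairs G S B₁ B₂ θ) := by
          refine lt_of_lt_of_le ?_ hf
          have : (0 : ℝ) < n := by exact_mod_cast (by omega : 0 < n)
          positivity
        exact_mod_cast this
      obtain ⟨p, hp⟩ := card_pos.1 hpos
      simp only [popularPairs, mem_filter] at hp
      have := hp.2.2.1.trans (card_le_univ _)
      rw [Fintype.card_fin] at this
      omega
    · rw [mem_filter]
      refine ⟨hX1, ?_⟩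
      rw [disjoint_right]
      intro e he
      simp only [F, mem_image] at he
      obtain ⟨p, hp, rfl⟩ := he
      exact hno p hp
  have hbound : ∀ t ∈ I, (#((powersetCard m E).filter fun X => Disjoint X (F t)) : ℝ) ≤
      Real.exp (-(c * m)) * #(powersetCard m E) := by
    intro t ht
    simp only [I, mem_filter] at ht
    have hFE : F t ⊆ E := by
      intro e he
      simp only [F, mem_image, popularPairs, mem_filter] at he
      obtain ⟨p, hp, rfl⟩ := he
      rw [hE, SimpleGraph.mem_edgeFinset]
      simpa using hp.2.1
    refine (card_powersetCard_disjoint_le E (F t) hFE (card_pos.1 hEpos) m).trans ?_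
    gcongr
    have h2 : (#(popularPairs G t.1.1 t.1.2.1 t.1.2.2 t.2) : ℝ) ≤ 2 * #(F t) := by
      exact_mod_cast card_le_two_mul_card_image_sym2 _
    have hE0 : (0 : ℝ) < #E := by exact_mod_cast hEpos
    rw [le_div_iff₀ hE0]
    -- Passing from ordered pairs to edges loses a factor `2`, which `#E ≤ n ^ 2 / 2` gives back.
    have h3 : c * #E ≤ #(F t) := by nlinarith [ht.2]
    calc c * m * #E = (c * #E) * m := by ring
      _ ≤ #(F t) * m := by gcongr
  calc _ ≤ ((#(I.biUnion fun t => (powersetCard m E).filter fun X => Disjoint X (F t)) : ℕ) : ℝ) := by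
        exact_mod_cast card_le_card hsub
    _ ≤ ∑ t ∈ I, (#((powersetCard m E).filter fun X => Disjoint X (F t)) : ℝ) := by
        exact_mod_cast card_biUnion_le
    _ ≤ ∑ t ∈ I, Real.exp (-(c * m)) * #(powersetCard m E) := sum_le_sum hbound
    _ = #I * (Real.exp (-(c * m)) * #(powersetCard m E)) := by rw [sum_const, nsmul_eq_mul]
    _ ≤ ((8 : ℝ) ^ n * (n + 1)) * (Real.exp (-(c * m)) * #(powersetCard m E)) := by
        gcongr
        have h1 : #I ≤ 8 ^ n * (n + 1) := by
          refine (card_filter_le _ _).trans ?_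
          rw [card_product, card_range, card_univ]
          simp only [Fintype.card_prod, Fintype.card_finset, Fintype.card_fin]
          rw [show (8 : ℕ) = 2 * (2 * 2) from rfl, mul_pow, mul_pow]
        exact_mod_cast h1
    _ = _ := by
        rw [edgeSetsOfSize]
        ring_nf
        rfl

/-- With linearly many random edges, all large sets of popular pairs are hit with high
probability. -/
lemma le_probRandomEdges_of_hitsPopularPairs {c ε : ℝ} (hc : 0 < c) (hε : 0 < ε) {n m : ℕ}
    (hn : 2 ≤ n) (G : SimpleGraph (Fin n)) [DecidableRel G.Adj] (hm : m ≤ n.choose 2)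
    (hnm : (4 + 1 / ε) / c * n ≤ m) (P : Finset (Sym2 (Fin n)) → Prop)
    (hP : ∀ X, HitsPopularPairs G X (c * (n : ℝ) ^ 2) → P X) :
    1 - ε ≤ probRandomEdges n m P := by
  classical
  have hpos : (0 : ℝ) < #(edgeSetsOfSize n m) := by
    have h : 0 < #(edgeSetsOfSize n m) := by
      rw [edgeSetsOfSize, card_powersetCard]
      apply Nat.choose_pos
      have := SimpleGraph.card_edgeFinset_top_eq_card_choose_two (V := Fin n)
      rw [Fintype.card_fin] at this
      refine hm.trans (le_of_eq ?_)
      rw [← this]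
    exact_mod_cast h
  rw [probRandomEdges, le_div_iff₀ hpos]
  have h1 := card_filter_not_hitsPopularPairs_le hn G hc m
  have h2 : #((edgeSetsOfSize n m).filter P) +
      #((edgeSetsOfSize n m).filter fun X => ¬ HitsPopularPairs G X (c * (n : ℝ) ^ 2)) ≥
      #(edgeSetsOfSize n m) := by
    refine le_trans ?_ (card_union_le _ _)
    apply card_le_card
    intro X hX
    rw [mem_union, mem_filter, mem_filter]
    by_cases h : HitsPopularPairs G X (c * (n : ℝ) ^ 2)
    · exact Or.inl ⟨hX, hP X h⟩
    · exact Or.inr ⟨hX, h⟩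
  have h2' : (#((edgeSetsOfSize n m).filter P) : ℝ) +
      #((edgeSetsOfSize n m).filter fun X => ¬ HitsPopularPairs G X (c * (n : ℝ) ^ 2)) ≥
      #(edgeSetsOfSize n m) := by exact_mod_cast h2
  -- The `4` in the hypothesis on `m` pays for `8 ≤ e ^ 3` and `n + 1 ≤ e ^ n`; what remains is `exp
  -- (-1/ε) ≤ ε`.
  have h3 : (8 : ℝ) ^ n * (n + 1) * Real.exp (-(c * m)) ≤ ε := by
    have e8 : (8 : ℝ) ≤ Real.exp 3 := by
      have := Real.exp_one_gt_d9
      have h : Real.exp 3 = Real.exp 1 ^ 3 := by rw [← Real.exp_nat_mul]; norm_num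
      rw [h]
      calc (8 : ℝ) = 2 ^ 3 := by norm_num
        _ ≤ _ := by gcongr; linarith
    have a1 : (8 : ℝ) ^ n ≤ Real.exp (3 * n) := by
      calc (8 : ℝ) ^ n ≤ Real.exp 3 ^ n := by gcongr
        _ = _ := by rw [← Real.exp_nat_mul]; ring_nf
    have a2 : (n : ℝ) + 1 ≤ Real.exp n := Real.add_one_le_exp _
    have hcm : (4 + 1 / ε) * n ≤ c * m := by
      calc (4 + 1 / ε) * n = c * ((4 + 1 / ε) / c * n) := by field_simp
        _ ≤ c * m := by gcongr
    have hn1 : (1 : ℝ) ≤ n := by exact_mod_cast (by omega : 1 ≤ n)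
    calc (8 : ℝ) ^ n * (n + 1) * Real.exp (-(c * m))
        ≤ Real.exp (3 * n) * Real.exp n * Real.exp (-(c * m)) := by gcongr
      _ = Real.exp (-(c * m - 4 * n)) := by rw [← Real.exp_add, ← Real.exp_add]; ring_nf
      _ ≤ Real.exp (-(1 / ε)) := by
          gcongr
          have : 1 / ε * 1 ≤ 1 / ε * n := by gcongr
          linarith
      _ ≤ ε := by
          rw [Real.exp_neg]
          apply inv_le_of_inv_le₀ hε
          have := Real.add_one_le_exp (1 / ε)
          rw [one_div] at *
          linarith
  nlinarith [mul_le_mul_of_nonneg_right h3 hpos.le]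

end

/-! ### Squared paths as lists. -/

section
open Finset

namespace SimpleGraph

/-- `l` is the vertex sequence of the square of a path in `H`. -/
def IsSquaredPath {V : Type*} (H : SimpleGraph V) : List V → Prop
  | [] => True
  | [_] => True
  | [a, b] => H.Adj a b
  | a :: b :: c :: l => H.Adj a b ∧ H.Adj a c ∧ IsSquaredPath H (b :: c :: l)

variable {V : Type*} {H : SimpleGraph V}

lemma isSquaredPath_cons_cons_cons {a b c : V} {l : List V} :
    H.IsSquaredPath (a :: b :: c :: l) ↔
      H.Adj a b ∧ H.Adj a c ∧ H.IsSquaredPath (b :: c :: l) := by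
  rw [IsSquaredPath]

lemma isSquaredPath_pair {a b : V} : H.IsSquaredPath [a, b] ↔ H.Adj a b := by
  rw [IsSquaredPath]

/-- Adjacencies reach only two places ahead, so an overlap of two vertices is enough to concatenate.
-/
lemma IsSquaredPath.glue {a b : V} {l m : List V} (h₁ : H.IsSquaredPath (l ++ [a, b]))
    (h₂ : H.IsSquaredPath (a :: b :: m)) : H.IsSquaredPath (l ++ a :: b :: m) := by
  induction l with
  | nil => exact h₂
  | cons x l ih =>
    match l with
    | [] =>
      simp only [List.cons_append, List.nil_append, isSquaredPath_cons_cons_cons] at h₁ ⊢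
      exact ⟨h₁.1, h₁.2.1, h₂⟩
    | [y] =>
      simp only [List.cons_append, List.nil_append, isSquaredPath_cons_cons_cons] at h₁ ih ⊢
      exact ⟨h₁.1, h₁.2.1, ih h₁.2.2⟩
    | y :: z :: l =>
      simp only [List.cons_append, isSquaredPath_cons_cons_cons] at h₁ ih ⊢
      exact ⟨h₁.1, h₁.2.1, ih h₁.2.2⟩

lemma IsSquaredPath.tail {a : V} {l : List V} (h : H.IsSquaredPath (a :: l)) :
    H.IsSquaredPath l := by
  match l, h with
  | [], _ => trivial
  | [_], _ => trivial
  | _ :: _ :: _, h => exact (isSquaredPath_cons_cons_cons.1 h).2.2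

lemma IsSquaredPath.of_append_right {l m : List V} (h : H.IsSquaredPath (l ++ m)) :
    H.IsSquaredPath m := by
  induction l with
  | nil => exact h
  | cons x l ih => exact ih h.tail

lemma IsSquaredPath.adj_one {l : List V} (h : H.IsSquaredPath l) {i : ℕ} (hi : i + 1 < l.length) :
    H.Adj l[i] l[i + 1] := by
  induction i generalizing l with
  | zero =>
    match l, h, hi with
    | [_, _], h, _ => exact isSquaredPath_pair.1 h
    | _ :: _ :: _ :: _, h, _ => exact (isSquaredPath_cons_cons_cons.1 h).1
  | succ i ih =>
    match l, h, hi with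
    | _ :: l, h, hi =>
      simpa using ih h.tail (by simpa using hi)

lemma IsSquaredPath.adj_two {l : List V} (h : H.IsSquaredPath l) {i : ℕ} (hi : i + 2 < l.length) :
    H.Adj l[i] l[i + 2] := by
  induction i generalizing l with
  | zero =>
    match l, h, hi with
    | _ :: _ :: _ :: _, h, _ => exact (isSquaredPath_cons_cons_cons.1 h).2.1
  | succ i ih =>
    match l, h, hi with
    | _ :: l, h, hi =>
      simpa using ih h.tail (by simp only [List.length_cons] at hi; omega)

/-- A squared path through all vertices that closes up to a cycle gives the square of a Hamilton
cycle. -/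
lemma containsHamiltonCycleSquare_of_list {n : ℕ} {H : SimpleGraph (Fin n)} {a b : Fin n}
    {l : List (Fin n)} (hnd : (a :: b :: l).Nodup) (hlen : (a :: b :: l).length = n)
    (h : H.IsSquaredPath ((a :: b :: l) ++ [a, b])) : H.ContainsHamiltonCycleSquare := by
  set L := a :: b :: l with hL
  have hn : 2 ≤ n := by rw [← hlen, hL]; simp
  let f : Fin n → Fin n := fun i => L[i.1]'(by omega)
  have hf : Function.Injective f := by
    intro i j hij
    have := (List.Nodup.getElem_inj_iff hnd).1 hij
    exact Fin.ext this
  let π : Equiv.Perm (Fin n) := Equiv.ofBijective f (Finite.injective_iff_bijective.1 hf)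
  have hlen' : (L ++ [a, b]).length = n + 2 := by rw [List.length_append, hlen]; rfl
  have hπ : ∀ i : Fin n, π i = (L ++ [a, b])[i.1]'(by omega) := by
    intro i
    rw [List.getElem_append_left (by omega)]
    rfl
  have hr : ∀ i : Fin n, (finRotate n i : ℕ) = if i.1 + 1 = n then 0 else i.1 + 1 := by
    intro i
    obtain ⟨k, rfl⟩ : ∃ k, n = k + 1 := ⟨n - 1, by omega⟩
    rw [coe_finRotate]
    by_cases hi : i = Fin.last k
    · simp [hi]
    · have : i.1 ≠ k := fun h => hi (Fin.ext h)
      simp [hi, this]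
  -- Positions `n` and `n + 1` of the extended list repeat positions `0` and `1`, so the cyclic
  -- adjacencies are read off as linear ones.
  have hwrap0 : (L ++ [a, b])[n]'(by omega) = (L ++ [a, b])[0]'(by omega) := by
    have e : n - L.length = 0 := by omega
    rw [List.getElem_append_right (by omega)]
    simp only [e]
    simp [hL]
  have hwrap1 : (L ++ [a, b])[n + 1]'(by omega) = (L ++ [a, b])[1]'(by omega) := by
    have e : n + 1 - L.length = 1 := by omega
    rw [List.getElem_append_right (by omega)]
    simp only [e]
    simp [hL]
  refine ⟨π, fun i => ⟨?_, ?_⟩⟩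
  · have h1 := h.adj_one (i := i.1) (by omega)
    rw [hπ, hπ]
    convert h1 using 1
    have := hr i
    split_ifs at this with hi
    · simp only [this, hi]
      exact hwrap0.symm
    · simp only [this]
  · have h1 := h.adj_two (i := i.1) (by omega)
    rw [hπ, hπ]
    convert h1 using 1
    have e1 := hr i
    have e2 := hr (finRotate n i)
    split_ifs at e1 with hi
    · rw [e1, if_neg (by omega)] at e2
      have e3 : i.1 + 2 = n + 1 := by omega
      simp only [e2, e3]
      exact hwrap1.symm
    · rw [e1] at e2
      split_ifs at e2 with hi2
      · have e3 : i.1 + 2 = n := by omega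
        simp only [e2, e3]
        exact hwrap0.symm
      · simp only [e2]

end SimpleGraph

end

/-! ### Inserting a vertex and connecting two edges. -/

section
open Finset SimpleGraph

set_option linter.unusedSectionVars false

variable {V : Type*} [DecidableEq V]

/-- A reverse Markov bound: a large sum of bounded terms forces many terms above the threshold. -/
lemma sum_le_card_filter_mul_add {ι : Type*} (P : Finset ι) (h g : ι → ℝ) {M t a : ℝ}
    (hM : ∀ p ∈ P, h p ≤ M) (hsmall : ∀ p ∈ P, g p < t → h p ≤ a) (ha : 0 ≤ a) :
    ∑ p ∈ P, h p ≤ #(P.filter fun p => t ≤ g p) * M + #P * a := by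
  rw [← sum_filter_add_sum_filter_not P (fun p => t ≤ g p)]
  gcongr
  · rw [← nsmul_eq_mul]
    exact sum_le_card_nsmul _ _ _ fun p hp => hM p (mem_filter.1 hp).1
  · calc _ ≤ #(P.filter fun p => ¬ t ≤ g p) • a := by
          refine sum_le_card_nsmul _ _ _ fun p hp => ?_
          rw [mem_filter, not_le] at hp
          exact hsmall p hp.1 hp.2
      _ ≤ #P * a := by
          rw [nsmul_eq_mul]
          gcongr
          exact filter_subset _ _

lemma mem_commonNbrs {G : SimpleGraph V} [DecidableRel G.Adj] {x y z : V} {B : Finset V} :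
    z ∈ commonNbrs G x y B ↔ z ∈ B ∧ G.Adj x z ∧ G.Adj y z := by
  simp [commonNbrs]

lemma sum_card_commonNbrs (G : SimpleGraph V) [DecidableRel G.Adj] (S B : Finset V) :
    ∑ p ∈ S ×ˢ S, #(commonNbrs G p.1 p.2 B) = ∑ z ∈ B, #(S.filter (G.Adj z)) ^ 2 := by
  have h : ∀ p ∈ S ×ˢ S, #(commonNbrs G p.1 p.2 B) =
      ∑ z ∈ B, if G.Adj z p.1 ∧ G.Adj z p.2 then 1 else 0 := by
    intro p _
    rw [commonNbrs, card_filter]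
    simp only [G.adj_comm]
  rw [sum_congr rfl h, sum_comm]
  refine sum_congr rfl fun z _ => ?_
  rw [← card_filter, sq, ← card_product, filter_product]

/-- Both sides count closed walks `p.1, r.1, p.2, r.2`, grouped by opposite corners. Large codegrees
on one diagonal thus produce pairs on the other that are popular towards `S₁` and `S₂` at once. -/
lemma sum_card_commonNbrs_mul (G : SimpleGraph V) [DecidableRel G.Adj] (Q S₁ S₂ : Finset V) :
    ∑ p ∈ Q ×ˢ Q, #(commonNbrs G p.1 p.2 S₁) * #(commonNbrs G p.1 p.2 S₂) =
      ∑ r ∈ S₁ ×ˢ S₂, #(commonNbrs G r.1 r.2 Q) ^ 2 := by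
  have h : ∀ p ∈ Q ×ˢ Q, #(commonNbrs G p.1 p.2 S₁) * #(commonNbrs G p.1 p.2 S₂) =
      ∑ r ∈ S₁ ×ˢ S₂, if (G.Adj r.1 p.1 ∧ G.Adj r.2 p.1) ∧ (G.Adj r.1 p.2 ∧ G.Adj r.2 p.2)
        then 1 else 0 := by
    intro p _
    rw [commonNbrs, commonNbrs, ← card_product, ← filter_product, card_filter]
    refine sum_congr rfl fun r _ => ?_
    congr 1
    simp only [eq_iff_iff, G.adj_comm r.1, G.adj_comm r.2]
    tauto
  rw [sum_congr rfl h, sum_comm]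
  refine sum_congr rfl fun r _ => ?_
  rw [← card_filter, sq, ← card_product]
  congr 1
  ext p
  simp only [mem_filter, mem_product, mem_commonNbrs]
  tauto

/-- Popular pairs are off the diagonal, which costs `#S`; this is the source of the terms `f + #S`
below. -/
lemma card_filter_le_card_popularPairs_add (G : SimpleGraph V) [DecidableRel G.Adj]
    (S B₁ B₂ : Finset V) (t : ℝ) :
    #((S ×ˢ S).filter fun p => t ≤ min (#(commonNbrs G p.1 p.2 B₁) : ℝ)
        #(commonNbrs G p.1 p.2 B₂)) ≤ #(popularPairs G S B₁ B₂ ⌈t⌉₊) + #S := by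
  have : (S ×ˢ S).filter (fun p => t ≤ min (#(commonNbrs G p.1 p.2 B₁) : ℝ)
        #(commonNbrs G p.1 p.2 B₂)) ⊆ popularPairs G S B₁ B₂ ⌈t⌉₊ ∪ S.diag := by
    intro p hp
    simp only [mem_filter, mem_product, le_min_iff] at hp
    simp only [mem_union, popularPairs, mem_filter, mem_product, mem_diag, Nat.ceil_le]
    tauto
  exact (card_le_card this).trans ((card_union_le _ _).trans (by rw [diag_card]))

section hits

variable {G : SimpleGraph V} [DecidableRel G.Adj] {X : Finset (Sym2 V)} {f : ℝ}

lemma HitsPopularPairs.exists_edge (hX : HitsPopularPairs G X f) (S B₁ B₂ : Finset V) (t : ℝ)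
    (h : f + #S ≤ #((S ×ˢ S).filter fun p => t ≤ min (#(commonNbrs G p.1 p.2 B₁) : ℝ)
        #(commonNbrs G p.1 p.2 B₂))) :
    ∃ x ∈ S, ∃ y ∈ S, x ≠ y ∧ s(x, y) ∈ X ∧ t ≤ #(commonNbrs G x y B₁) ∧
      t ≤ #(commonNbrs G x y B₂) := by
  have h1 : (#((S ×ˢ S).filter fun p => t ≤ min (#(commonNbrs G p.1 p.2 B₁) : ℝ)
        #(commonNbrs G p.1 p.2 B₂)) : ℝ) ≤ #(popularPairs G S B₁ B₂ ⌈t⌉₊) + #S := by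
    exact_mod_cast card_filter_le_card_popularPairs_add G S B₁ B₂ t
  obtain ⟨p, hp, hpX⟩ := hX S B₁ B₂ ⌈t⌉₊ (by linarith)
  simp only [popularPairs, mem_filter, mem_product, Nat.ceil_le] at hp
  exact ⟨p.1, hp.1.1, p.2, hp.1.2, hp.2.1, hpX, hp.2.2.1, hp.2.2.2⟩

lemma HitsPopularPairs.exists_edge_mem (hX : HitsPopularPairs G X f) (S : Finset V)
    (h : f + #S ≤ (#S : ℝ) ^ 2) : ∃ x ∈ S, ∃ y ∈ S, x ≠ y ∧ s(x, y) ∈ X := by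
  -- With threshold `0` every pair of distinct vertices of `S` is popular.
  obtain ⟨x, hx, y, hy, hxy, h, -⟩ := hX.exists_edge S ∅ ∅ 0 (by
    rw [filter_true_of_mem (fun p _ => by positivity), card_product]
    push_cast
    nlinarith)
  exact ⟨x, hx, y, hy, hxy, h⟩

/-- If the bipartite graph between `S` and `B` has density at least `d`, some edge of `X` inside
`S` has many common neighbours in `B`. -/
lemma HitsPopularPairs.exists_edge_of_dense (hX : HitsPopularPairs G X f) (S B : Finset V)
    (hB : B.Nonempty) {d : ℝ} (hd : 0 ≤ d)
    (hSB : d * #S * #B ≤ ∑ z ∈ B, (#(S.filter (G.Adj z)) : ℝ))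
    (h : f + #S ≤ d ^ 2 * (#S : ℝ) ^ 2 / 2) :
    ∃ x ∈ S, ∃ y ∈ S, x ≠ y ∧ s(x, y) ∈ X ∧ d ^ 2 * #B / 2 ≤ #(commonNbrs G x y B) := by
  have hB0 : (0 : ℝ) < #B := by exact_mod_cast hB.card_pos
  obtain ⟨x, hx, y, hy, hxy, h1, h2, -⟩ := hX.exists_edge S B B (d ^ 2 * #B / 2) (by
    refine h.trans ?_
    -- By Cauchy–Schwarz the average codegree into `B` is at least `d ^ 2 * #B`. Pairs below half of
    -- this contribute at most half of the sum, and the others at most `#B` each.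
    have e1 : ∑ p ∈ S ×ˢ S, (#(commonNbrs G p.1 p.2 B) : ℝ) =
        ∑ z ∈ B, (#(S.filter (G.Adj z)) : ℝ) ^ 2 := by
      exact_mod_cast sum_card_commonNbrs G S B
    have e2 : (∑ z ∈ B, (#(S.filter (G.Adj z)) : ℝ)) ^ 2 ≤
        #B * ∑ z ∈ B, (#(S.filter (G.Adj z)) : ℝ) ^ 2 := sq_sum_le_card_mul_sum_sq
    have e3 : (d * #S * #B) ^ 2 ≤ (∑ z ∈ B, (#(S.filter (G.Adj z)) : ℝ)) ^ 2 := by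
      gcongr
    have e4 : d ^ 2 * (#S : ℝ) ^ 2 * #B ≤ ∑ p ∈ S ×ˢ S, (#(commonNbrs G p.1 p.2 B) : ℝ) := by
      rw [e1]
      refine le_of_mul_le_mul_left ?_ hB0
      nlinarith
    have e5 := sum_le_card_filter_mul_add (S ×ˢ S) (fun p => (#(commonNbrs G p.1 p.2 B) : ℝ))
      (fun p => min (#(commonNbrs G p.1 p.2 B) : ℝ) #(commonNbrs G p.1 p.2 B)) (M := #B)
      (t := d ^ 2 * #B / 2) (a := d ^ 2 * #B / 2)
      (fun p _ => by
        simp only [commonNbrs]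
        exact_mod_cast card_filter_le _ _)
      (fun p _ hp => by rw [min_self] at hp; exact hp.le) (by positivity)
    rw [card_product] at e5
    push_cast at e5
    refine le_of_mul_le_mul_right ?_ hB0
    nlinarith)
  exact ⟨x, hx, y, hy, hxy, h1, h2⟩

end hits

/-- Any two vertices (possibly equal) have at least `q` common neighbours in `Q`. -/
def CommonNbrsGE (G : SimpleGraph V) [DecidableRel G.Adj] (Q : Finset V) (q : ℝ) : Prop :=
  ∀ x y, q ≤ #(commonNbrs G x y Q)

section rich

variable {G : SimpleGraph V} [DecidableRel G.Adj] {X : Finset (Sym2 V)} {f q : ℝ} {Q : Finset V}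

lemma CommonNbrsGE.sdiff (h : CommonNbrsGE G Q q) (U : Finset V) :
    CommonNbrsGE G (Q \ U) (q - #U) := by
  intro x y
  have h1 : commonNbrs G x y Q ⊆ commonNbrs G x y (Q \ U) ∪ U := by
    intro z
    simp only [mem_union, mem_commonNbrs, mem_sdiff]
    tauto
  have h2 : (#(commonNbrs G x y Q) : ℝ) ≤ #(commonNbrs G x y (Q \ U)) + #U := by
    exact_mod_cast (card_le_card h1).trans (card_union_le _ _)
  linarith [h x y]

lemma CommonNbrsGE.mono (h : CommonNbrsGE G Q q) {q' : ℝ} (hq : q' ≤ q) :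
    CommonNbrsGE G Q q' := fun x y => hq.trans (h x y)

lemma adj_addEdges_of_adj {x y : V} (h : G.Adj x y) : (G.addEdges X).Adj x y := by
  rw [SimpleGraph.addEdges, sup_adj]
  exact Or.inl h

lemma adj_addEdges_of_mem {x y : V} (h : s(x, y) ∈ X) (hxy : x ≠ y) :
    (G.addEdges X).Adj x y := by
  rw [SimpleGraph.addEdges, sup_adj, fromEdgeSet_adj]
  exact Or.inr ⟨by exact_mod_cast h, hxy⟩

/-- The numerical condition under which vertices can be inserted and paths connected. -/
def Flexible (n q f : ℝ) : Prop :=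
  0 < n ∧ 0 < q ∧ 4 ≤ q ^ 4 / (2 * n ^ 3) ∧ f + n ≤ (q ^ 4 / (2 * n ^ 3)) ^ 2 / 4

variable [Fintype V]

/-- The edge `bc` of `X` lies inside the neighbourhood of `w`, and `a`, `d` are common neighbours of
`b` and `c` in that same neighbourhood. When `w` is dropped, `ac`, `bc`, `bd` take over. -/
lemma exists_insertion (hX : HitsPopularPairs G X f) (hQ : CommonNbrsGE G Q q)
    (hF : Flexible (Fintype.card V) q f) {w : V} (hw : w ∉ Q) :
    ∃ a b c d, a ∈ Q ∧ b ∈ Q ∧ c ∈ Q ∧ d ∈ Q ∧ [a, b, w, c, d].Nodup ∧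
      (G.addEdges X).IsSquaredPath [a, b, w, c, d] ∧
      (G.addEdges X).IsSquaredPath [a, b, c, d] := by
  set n : ℝ := (Fintype.card V : ℝ) with hn
  obtain ⟨hn0, hq0, h4, hfn⟩ := hF
  set t := q ^ 4 / (2 * n ^ 3) with ht
  set S := commonNbrs G w w Q with hS
  have hqS : q ≤ #S := hQ w w
  have hSn : (#S : ℝ) ≤ n := by rw [hn]; exact_mod_cast card_le_univ S
  have hqn : q ≤ n := hqS.trans hSn
  have hS0 : (0 : ℝ) < #S := hq0.trans_le hqS
  have htle : t ≤ q ^ 2 / (2 * n) := by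
    rw [ht, div_le_div_iff₀ (by positivity) (by positivity)]
    have : q ^ 2 ≤ n ^ 2 := by gcongr
    have h2 : 0 ≤ q ^ 2 * (2 * n) := by positivity
    nlinarith
  have htq : t ≤ q := by
    refine htle.trans ?_
    rw [div_le_iff₀ (by positivity)]
    nlinarith
  -- The neighbours of `z` inside `S` include the common neighbours of `w` and `z` in `Q`.
  have hdense : q / #S * #S * #S ≤ ∑ z ∈ S, (#(S.filter (G.Adj z)) : ℝ) := by
    rw [div_mul_cancel₀ _ hS0.ne', mul_comm, ← nsmul_eq_mul]
    refine card_nsmul_le_sum _ _ _ fun z hz => (hQ w z).trans ?_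
    have : commonNbrs G w z Q ⊆ S.filter (G.Adj z) := by
      intro u
      simp only [hS, mem_filter, mem_commonNbrs]
      tauto
    exact_mod_cast card_le_card this
  obtain ⟨x, hx, y, hy, hxy, hxyX, hcom⟩ := hX.exists_edge_of_dense S S
    (card_pos.1 (by exact_mod_cast hS0)) (by positivity) hdense (by
      have : (q / #S) ^ 2 * (#S : ℝ) ^ 2 / 2 = q ^ 2 / 2 := by field_simp
      rw [this]
      have : t ^ 2 ≤ q ^ 2 := by gcongr
      nlinarith)
  have hcom2 : 4 ≤ #(commonNbrs G x y S) := by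
    have e : q ^ 2 / (2 * n) ≤ (q / #S) ^ 2 * #S / 2 := by
      have : (q / #S) ^ 2 * #S / 2 = q ^ 2 / (2 * #S) := by field_simp
      rw [this]
      gcongr
    have : (4 : ℝ) ≤ #(commonNbrs G x y S) := by linarith
    exact_mod_cast this
  obtain ⟨a, ha⟩ := card_pos.1 (by omega : 0 < #(commonNbrs G x y S))
  obtain ⟨d, hd⟩ := card_pos.1 (by
    have := pred_card_le_card_erase (s := commonNbrs G x y S) (a := a)
    omega : 0 < #((commonNbrs G x y S).erase a))
  rw [mem_erase] at hd
  obtain ⟨hda, hd⟩ := hd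
  simp only [hS, mem_commonNbrs, and_self] at ha hd hx hy
  refine ⟨a, x, y, d, ha.1.1, hx.1, hy.1, hd.1.1, ?_, ?_, ?_⟩
  · have hne : ∀ z ∈ Q, z ≠ w := fun z hz h => hw (h ▸ hz)
    simp only [List.nodup_cons, List.mem_cons, List.not_mem_nil, or_false, not_or,
      not_false_eq_true, List.nodup_nil, and_true]
    exact ⟨⟨ha.2.1.ne', hne a ha.1.1, ha.2.2.ne', hda.symm⟩, ⟨hne x hx.1, hxy, hd.2.1.ne⟩,
      ⟨(hne y hy.1).symm, (hne d hd.1.1).symm⟩, hd.2.2.ne⟩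
  · simp only [isSquaredPath_cons_cons_cons, isSquaredPath_pair]
    exact ⟨adj_addEdges_of_adj ha.2.1.symm, adj_addEdges_of_adj ha.1.2.symm,
      adj_addEdges_of_adj hx.2.symm, adj_addEdges_of_mem hxyX hxy, adj_addEdges_of_adj hy.2,
      adj_addEdges_of_adj hd.1.2, adj_addEdges_of_adj hd.2.2⟩
  · simp only [isSquaredPath_cons_cons_cons, isSquaredPath_pair]
    exact ⟨adj_addEdges_of_adj ha.2.1.symm, adj_addEdges_of_adj ha.2.2.symm,
      adj_addEdges_of_mem hxyX hxy, adj_addEdges_of_adj hd.2.1, adj_addEdges_of_adj hd.2.2⟩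

/-- The link is `u v m m' y z` with `uv`, `mm'`, `yz` in `X`. The middle edge is chosen first, with
many common neighbours both in those of `a, b` and in those of `c, d`; `uv` and `yz` are then found
inside these two sets. -/
lemma exists_connector (hX : HitsPopularPairs G X f) (hQ : CommonNbrsGE G Q q)
    (hF : Flexible (Fintype.card V) q f) {a b c d : V} (hab : (G.addEdges X).Adj a b)
    (hcd : (G.addEdges X).Adj c d) :
    ∃ K : List V, K.Nodup ∧ K.length = 6 ∧ (∀ x ∈ K, x ∈ Q) ∧
      (G.addEdges X).IsSquaredPath (a :: b :: (K ++ [c, d])) := by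
  set n : ℝ := (Fintype.card V : ℝ) with hn
  obtain ⟨hn0, hq0, h4, hfn⟩ := hF
  -- The codegree products sum to at least `q ^ 4`. Pairs whose smaller codegree is below `t`
  -- contribute at most `n ^ 2 * (t * n) = q ^ 4 / 2`; the others contribute at most `n ^ 2` each,
  -- so there are at least `t * n` of them.
  set t := q ^ 4 / (2 * n ^ 3) with ht
  set S₁ := commonNbrs G a b Q with hS₁
  set S₂ := commonNbrs G c d Q with hS₂
  have hcard : ∀ S : Finset V, (#S : ℝ) ≤ n := fun S => by rw [hn]; exact_mod_cast card_le_univ S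
  have hqn : q ≤ n := (hQ a b).trans (hcard _)
  have htn : t * n ^ 3 = q ^ 4 / 2 := by rw [ht]; field_simp
  have htle : t ≤ n := by
    refine le_of_mul_le_mul_right (a := n ^ 3) ?_ (by positivity)
    rw [htn]
    have : q ^ 4 ≤ n ^ 4 := by gcongr
    nlinarith [pow_pos hn0 4]
  have hmid : f + #Q ≤ #((Q ×ˢ Q).filter fun p => t ≤ min (#(commonNbrs G p.1 p.2 S₁) : ℝ)
      #(commonNbrs G p.1 p.2 S₂)) := by
    have e1 : ∑ p ∈ Q ×ˢ Q, (#(commonNbrs G p.1 p.2 S₁) : ℝ) * #(commonNbrs G p.1 p.2 S₂) =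
      ∑ r ∈ S₁ ×ˢ S₂, (#(commonNbrs G r.1 r.2 Q) : ℝ) ^ 2 := by
      exact_mod_cast sum_card_commonNbrs_mul G Q S₁ S₂
    have e2 : q ^ 4 ≤ ∑ r ∈ S₁ ×ˢ S₂, (#(commonNbrs G r.1 r.2 Q) : ℝ) ^ 2 := by
      calc q ^ 4 = (q * q) * q ^ 2 := by ring
        _ ≤ ((#S₁ : ℝ) * #S₂) * q ^ 2 := by
            gcongr
            · exact hQ a b
            · exact hQ c d
        _ = #(S₁ ×ˢ S₂) • q ^ 2 := by rw [card_product, nsmul_eq_mul]; push_cast; ring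
        _ ≤ _ := by
            refine card_nsmul_le_sum _ _ _ fun r _ => ?_
            have := hQ r.1 r.2
            gcongr
    have e3 := sum_le_card_filter_mul_add (Q ×ˢ Q)
      (fun p => (#(commonNbrs G p.1 p.2 S₁) : ℝ) * #(commonNbrs G p.1 p.2 S₂))
      (fun p => min (#(commonNbrs G p.1 p.2 S₁) : ℝ) #(commonNbrs G p.1 p.2 S₂)) (M := n ^ 2)
      (t := t) (a := t * n)
      (fun p _ => by
        rw [sq]
        gcongr <;> exact hcard _)
      (fun p _ hp => by
        rcases min_lt_iff.1 hp with h | h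
        · gcongr
          exact hcard _
        · rw [mul_comm]
          gcongr
          exact hcard _) (by positivity)
    rw [e1, card_product] at e3
    push_cast at e3
    set P : ℝ := (#((Q ×ˢ Q).filter fun p => t ≤ min (#(commonNbrs G p.1 p.2 S₁) : ℝ)
      #(commonNbrs G p.1 p.2 S₂)) : ℝ) with hP
    have e4 : (#Q : ℝ) * #Q * (t * n) ≤ n * n * (t * n) := by
      gcongr <;> exact hcard _
    have e5 : t * n ≤ P := by
      refine le_of_mul_le_mul_right (a := n ^ 2) ?_ (by positivity)
      nlinarith
    have := hcard Q
    nlinarith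
  obtain ⟨m, hm, m', hm', hne, hmX, h1, h2⟩ := hX.exists_edge Q S₁ S₂ t hmid
  obtain ⟨u, hu, v, hv, huv, huvX⟩ := hX.exists_edge_mem (commonNbrs G m m' S₁) (by
    have := hcard (commonNbrs G m m' S₁)
    nlinarith)
  -- `S₁` and `S₂` may overlap, so `u` and `v` are removed. Since `4 ≤ t`, at least `t - 2 ≥ t / 2`
  -- vertices remain, whence the bound `t ^ 2 / 4` in `Flexible`.
  set R := commonNbrs G m m' S₂ \ {u, v} with hR
  have hRcard : t - 2 ≤ #R := by
    have e1 : #(commonNbrs G m m' S₂) - #{u, v} ≤ #R := le_card_sdiff _ _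
    have e2 := card_le_two (a := u) (b := v)
    have e3 : #(commonNbrs G m m' S₂) ≤ #R + 2 := by omega
    have : (#(commonNbrs G m m' S₂) : ℝ) ≤ #R + 2 := by exact_mod_cast e3
    linarith
  obtain ⟨y, hy, z, hz, hyz, hyzX⟩ := hX.exists_edge_mem R (by
    have := hcard R
    nlinarith)
  simp only [hR, hS₁, hS₂, mem_sdiff, mem_insert, mem_singleton, not_or, mem_commonNbrs]
    at hu hv hy hz
  refine ⟨[u, v, m, m', y, z], ?_, rfl, ?_, ?_⟩
  · simp only [List.nodup_cons, List.mem_cons, List.not_mem_nil, or_false, not_or,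
      not_false_eq_true, List.nodup_nil, and_true]
    exact ⟨⟨huv, hu.2.1.ne', hu.2.2.ne', fun h => hy.2.1 h.symm, fun h => hz.2.1 h.symm⟩,
      ⟨hv.2.1.ne', hv.2.2.ne', fun h => hy.2.2 h.symm, fun h => hz.2.2 h.symm⟩,
      ⟨hne, hy.1.2.1.ne, hz.1.2.1.ne⟩, ⟨hy.1.2.2.ne, hz.1.2.2.ne⟩, hyz⟩
  · intro x hx
    simp only [List.mem_cons, List.not_mem_nil, or_false] at hx
    rcases hx with rfl | rfl | rfl | rfl | rfl | rfl
    · exact hu.1.1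
    · exact hv.1.1
    · exact hm
    · exact hm'
    · exact hy.1.1.1
    · exact hz.1.1.1
  · simp only [List.cons_append, List.nil_append, isSquaredPath_cons_cons_cons,
      isSquaredPath_pair]
    exact ⟨hab, adj_addEdges_of_adj hu.1.2.1, adj_addEdges_of_adj hu.1.2.2,
      adj_addEdges_of_adj hv.1.2.2, adj_addEdges_of_mem huvX huv,
      adj_addEdges_of_adj hu.2.1.symm, adj_addEdges_of_adj hv.2.1.symm,
      adj_addEdges_of_adj hv.2.2.symm, adj_addEdges_of_mem hmX hne, adj_addEdges_of_adj hy.1.2.1,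
      adj_addEdges_of_adj hy.1.2.2, adj_addEdges_of_adj hz.1.2.2, adj_addEdges_of_mem hyzX hyz,
      adj_addEdges_of_adj hy.1.1.2.1.symm, adj_addEdges_of_adj hz.1.1.2.1.symm,
      adj_addEdges_of_adj hz.1.1.2.2.symm, hcd⟩

end rich

end

/-! ### Paths with deletable vertices and their concatenation. -/

section
open Finset SimpleGraph

set_option linter.unusedSectionVars false

variable {V : Type*} [DecidableEq V]

/-- Removing any vertices of `E` from `l` leaves a squared path. -/
def DeletablePath (H : SimpleGraph V) (E : Finset V) (l : List V) : Prop :=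
  ∀ D ⊆ E, H.IsSquaredPath (l.filter (· ∉ D))

/-- A squared path on at least four vertices from which any vertices of `E` may be removed, and
whose first two and last two vertices lie outside `E`. -/
def IsPiece (H : SimpleGraph V) (E : Finset V) (l : List V) : Prop :=
  DeletablePath H E l ∧
    ∃ a b m c d, l = a :: b :: (m ++ [c, d]) ∧ a ∉ E ∧ b ∉ E ∧ c ∉ E ∧ d ∉ E

lemma DeletablePath.isSquaredPath {H : SimpleGraph V} {E : Finset V} {l : List V}
    (h : DeletablePath H E l) : H.IsSquaredPath l := by
  have := h ∅ (empty_subset _)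
  simpa using this

lemma isPiece_of_length {H : SimpleGraph V} {l : List V} (h : H.IsSquaredPath l)
    (hl : 4 ≤ l.length) : IsPiece H ∅ l := by
  refine ⟨fun D hD => ?_, ?_⟩
  · rw [subset_empty.1 hD]
    simpa using h
  · match l, hl with
    | a :: b :: l, hl =>
      rcases List.eq_nil_or_concat l with rfl | ⟨l, d, rfl⟩
      · simp at hl
      rcases List.eq_nil_or_concat l with rfl | ⟨l, c, rfl⟩
      · simp at hl
      exact ⟨a, b, l, c, d, by simp, by simp⟩

section rich

variable {G : SimpleGraph V} [DecidableRel G.Adj] {X : Finset (Sym2 V)} {f q : ℝ}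
  {E : Finset V} [Fintype V]

/-- Greedy: every insertion consumes four vertices of `Q` and lowers codegrees by at most four. With
`E` containing `ws` this yields absorbing pieces, with `E = ∅` it covers leftover vertices. -/
lemma exists_insertions (hX : HitsPopularPairs G X f) (hF : Flexible (Fintype.card V) q f)
    (ws : List V) {Q : Finset V} (hQ : CommonNbrsGE G Q (q + 4 * ws.length))
    (hws : ∀ w ∈ ws, w ∉ Q) (hQE : Disjoint Q E) :
    ∃ (K : List V) (ps : List (List V)), K.Nodup ∧ (∀ x ∈ K, x ∈ Q) ∧ K.length = 4 * ws.length ∧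
      ps.length = ws.length ∧ ps.flatten.Perm (K ++ ws) ∧
      ∀ p ∈ ps, IsPiece (G.addEdges X) E p := by
  induction ws generalizing Q with
  | nil => exact ⟨[], [], by simp⟩
  | cons w ws ih =>
    obtain ⟨a, b, c, d, ha, hb, hc, hd, hnd, h5, h4⟩ := exists_insertion hX
      (hQ.mono (by rw [le_add_iff_nonneg_right]; positivity)) hF (hws w List.mem_cons_self)
    have hcard : #({a, b, c, d} : Finset V) ≤ 4 := card_le_four
    obtain ⟨K, ps, hK, hKQ, hKl, hpsl, hperm, hps⟩ := ih (Q := Q \ {a, b, c, d})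
      ((hQ.sdiff {a, b, c, d}).mono (by
        have : (#({a, b, c, d} : Finset V) : ℝ) ≤ 4 := by exact_mod_cast hcard
        rw [List.length_cons]
        push_cast
        linarith))
      (fun w hw h => hws w (List.mem_cons_of_mem _ hw) (mem_sdiff.1 h).1)
      (hQE.mono_left sdiff_subset)
    have hnE : ∀ x ∈ Q, x ∉ E := fun x hx => disjoint_left.1 hQE hx
    refine ⟨a :: b :: c :: d :: K, [a, b, w, c, d] :: ps, ?_, ?_, ?_, ?_, ?_, ?_⟩
    · have hnK : ∀ x ∈ ({a, b, c, d} : Finset V), x ∉ K := fun x hx h =>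
        (mem_sdiff.1 (hKQ x h)).2 hx
      simp only [mem_insert, mem_singleton, forall_eq_or_imp, forall_eq] at hnK
      simp only [List.nodup_cons, List.mem_cons, List.not_mem_nil, or_false, not_or,
        not_false_eq_true, List.nodup_nil, and_true] at hnd ⊢
      tauto
    · intro x hx
      simp only [List.mem_cons] at hx
      rcases hx with rfl | rfl | rfl | rfl | hx
      · exact ha
      · exact hb
      · exact hc
      · exact hd
      · exact (mem_sdiff.1 (hKQ x hx)).1
    · simp only [List.length_cons, hKl]
      ring
    · simp [hpsl]
    · rw [List.flatten_cons]
      have h1 := hperm.append_left [a, b, w, c, d]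
      refine h1.trans ?_
      simp only [List.cons_append, List.nil_append]
      refine List.Perm.cons a (List.Perm.cons b ?_)
      have : (w :: c :: d :: (K ++ ws)).Perm ((c :: d :: K) ++ w :: ws) :=
        (List.perm_middle (l₁ := c :: d :: K) (a := w) (l₂ := ws)).symm
      exact this
    · intro p hp
      rw [List.mem_cons] at hp
      rcases hp with rfl | hp
      · refine ⟨fun D hD => ?_, a, b, [w], c, d, rfl, hnE a ha, hnE b hb, hnE c hc, hnE d hd⟩
        have hnD : ∀ x ∈ Q, x ∉ D := fun x hx h => hnE x hx (hD h)
        by_cases hw : w ∈ D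
        · simpa [List.filter_cons, hnD a ha, hnD b hb, hnD c hc, hnD d hd, hw] using h4
        · simpa [List.filter_cons, hnD a ha, hnD b hb, hnD c hc, hnD d hd, hw] using h5
      · exact hps p hp

/-- The connector and the end pairs avoid `E`, so deletion commutes with gluing. -/
lemma DeletablePath.join {H : SimpleGraph V} {m K p : List V} {c d a b : V}
    (h : DeletablePath H E (m ++ [c, d])) (hp : DeletablePath H E (a :: b :: p))
    (hK : H.IsSquaredPath (c :: d :: (K ++ [a, b]))) (hKE : ∀ x ∈ K, x ∉ E) (ha : a ∉ E)
    (hb : b ∉ E) (hc : c ∉ E) (hd : d ∉ E) :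
    DeletablePath H E (m ++ [c, d] ++ (K ++ a :: b :: p)) := by
  intro D hD
  have hnD : ∀ x, x ∉ E → x ∉ D := fun x hx h => hx (hD h)
  have h1 := h D hD
  have h2 := hp D hD
  have hKf : K.filter (· ∉ D) = K := List.filter_eq_self.2 fun x hx => by
    simpa using hnD x (hKE x hx)
  simp only [List.filter_append, List.filter_cons, hnD a ha, hnD b hb, hnD c hc, hnD d hd,
    not_false_eq_true, decide_true, if_true, List.filter_nil, hKf] at h1 h2 ⊢
  have h3 := h1.glue hK
  have h4 : H.IsSquaredPath ((m.filter (· ∉ D) ++ c :: d :: K) ++ [a, b]) := by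
    simpa using h3
  have h5 := h4.glue h2
  simpa using h5

/-- Greedy, at six vertices of `Q` per connection. The initial path may be a single edge (`m = []`),
which lets the chain start at the end of another path. -/
lemma exists_chain (hX : HitsPopularPairs G X f) (hF : Flexible (Fintype.card V) q f)
    (ps : List (List V)) (hps : ∀ p ∈ ps, IsPiece (G.addEdges X) E p) {Q : Finset V}
    (hQ : CommonNbrsGE G Q (q + 6 * ps.length)) (hQE : Disjoint Q E) {m : List V} {c d : V}
    (hc : c ∉ E) (hd : d ∉ E) (h : DeletablePath (G.addEdges X) E (m ++ [c, d])) :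
    ∃ K t : List V, K.Nodup ∧ (∀ x ∈ K, x ∈ Q) ∧ K.length = 6 * ps.length ∧
      t.Perm (K ++ ps.flatten) ∧ DeletablePath (G.addEdges X) E (m ++ [c, d] ++ t) ∧
      ∃ m' c' d', m ++ [c, d] ++ t = m' ++ [c', d'] ∧ c' ∉ E ∧ d' ∉ E := by
  induction ps generalizing Q m c d with
  | nil => exact ⟨[], [], by simp, by simp, by simp, by simp, by simpa using h, m, c, d, by simp,
      hc, hd⟩
  | cons p ps ih =>
    obtain ⟨hpd, a, b, r, c₁, d₁, rfl, ha, hb, hc₁, hd₁⟩ := hps p List.mem_cons_self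
    have hcd : (G.addEdges X).Adj c d := isSquaredPath_pair.1 h.isSquaredPath.of_append_right
    have hab : (G.addEdges X).Adj a b := by
      have := hpd.isSquaredPath.adj_one (i := 0) (by simp)
      simpa using this
    obtain ⟨K₁, hK₁, hK₁l, hK₁Q, hK₁s⟩ := exists_connector hX
      (hQ.mono (by rw [le_add_iff_nonneg_right]; positivity)) hF hcd hab
    have hnE : ∀ x ∈ Q, x ∉ E := fun x hx => disjoint_left.1 hQE hx
    have hj := h.join hpd hK₁s (fun x hx => hnE x (hK₁Q x hx)) ha hb hc hd
    have hj' : m ++ [c, d] ++ (K₁ ++ a :: b :: (r ++ [c₁, d₁])) =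
        (m ++ [c, d] ++ (K₁ ++ a :: b :: r)) ++ [c₁, d₁] := by simp
    rw [hj'] at hj
    obtain ⟨K, t, hK, hKQ, hKl, ht, htd, m', c', d', htm, hc', hd'⟩ := ih
      (fun p hp => hps p (List.mem_cons_of_mem _ hp)) (Q := Q \ K₁.toFinset)
      ((hQ.sdiff K₁.toFinset).mono (by
        have : (#K₁.toFinset : ℝ) ≤ 6 := by exact_mod_cast hK₁l ▸ List.toFinset_card_le K₁
        rw [List.length_cons]
        push_cast
        linarith)) (hQE.mono_left sdiff_subset) hc₁ hd₁ hj
    refine ⟨K₁ ++ K, K₁ ++ a :: b :: (r ++ [c₁, d₁]) ++ t, ?_, ?_, ?_, ?_, ?_, m', c', d', ?_,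
      hc', hd'⟩
    · rw [List.nodup_append']
      refine ⟨hK₁, hK, fun x hx hx' => ?_⟩
      exact (mem_sdiff.1 (hKQ x hx')).2 (List.mem_toFinset.2 hx)
    · intro x hx
      rw [List.mem_append] at hx
      rcases hx with hx | hx
      · exact hK₁Q x hx
      · exact (mem_sdiff.1 (hKQ x hx)).1
    · rw [List.length_append, List.length_cons, hK₁l, hKl]
      ring
    · rw [List.flatten_cons, List.append_assoc, List.append_assoc]
      refine List.Perm.append_left K₁ ?_
      refine (ht.append_left _).trans ?_
      rw [← List.append_assoc, ← List.append_assoc]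
      exact List.Perm.append_right _ List.perm_append_comm
    · simpa using htd
    · rw [← htm]
      simp

end rich

end

/-! ### The reservoir and the absorbing path. -/

section
open Finset SimpleGraph

set_option linter.unusedSectionVars false

variable {V : Type*} [DecidableEq V] [Fintype V]

/-- A small set meeting every large set of a family in many elements, by the method of
conditional expectations. -/
lemma exists_card_eq_forall_half_pow_le {ι : Type*} [Fintype ι] (S : ι → Finset V) {g : ℝ}
    (hg0 : 0 < g) (hg1 : g ≤ 1) (hS : ∀ i, g * Fintype.card V ≤ #(S i)) (T : ℕ)
    (hT : (T : ℝ) ≤ g * Fintype.card V / 2) :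
    ∃ D : Finset V, #D = T ∧
      ∑ i, (1 / 2 : ℝ) ^ #(S i ∩ D) ≤ Fintype.card ι * (1 - g / 4) ^ T := by
  induction T with
  | zero => exact ⟨∅, by simp, by simp⟩
  | succ T ih =>
    push_cast at hT
    obtain ⟨D, hD, hΦ⟩ := ih (by linarith)
    have hV : (0 : ℝ) ≤ Fintype.card V := by positivity
    have hDc : (#Dᶜ : ℝ) = Fintype.card V - T := by
      rw [card_compl, Nat.cast_sub (card_le_univ D), hD]
    have hDc0 : (0 : ℝ) < #Dᶜ := by nlinarith
    -- Averaging over the next element `d`: at least `g|V| - T ≥ g|V|/2` candidates lie in `S i`,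
    -- and each of them halves the term of `i`.
    have hsum : ∑ d ∈ Dᶜ, ∑ i, (1 / 2 : ℝ) ^ #(S i ∩ insert d D) ≤
        ∑ d ∈ Dᶜ, (1 - g / 4) * ∑ i, (1 / 2 : ℝ) ^ #(S i ∩ D) := by
      rw [sum_comm, sum_const, nsmul_eq_mul, mul_sum, mul_sum]
      refine sum_le_sum fun i _ => ?_
      have h1 : ∀ d ∈ Dᶜ, (1 / 2 : ℝ) ^ #(S i ∩ insert d D) =
          (1 / 2 : ℝ) ^ #(S i ∩ D) * (1 - (if d ∈ S i then (1 / 2 : ℝ) else 0)) := by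
        intro d hd
        rw [mem_compl] at hd
        by_cases h : d ∈ S i
        · rw [inter_insert_of_mem h, card_insert_of_notMem (fun h' => hd (mem_inter.1 h').2),
            if_pos h, pow_succ]
          norm_num
        · rw [inter_insert_of_notMem h, if_neg h]
          ring
      rw [sum_congr rfl h1, ← mul_sum, sum_sub_distrib, sum_const, ← sum_filter, sum_const,
        nsmul_eq_mul, nsmul_eq_mul, mul_one]
      have h2 : g * Fintype.card V ≤ #(Dᶜ.filter (· ∈ S i)) + T := by
        refine (hS i).trans ?_
        have : S i ⊆ Dᶜ.filter (· ∈ S i) ∪ D := by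
          intro x hx
          simp only [mem_union, mem_filter, mem_compl]
          tauto
        have := (card_le_card this).trans (card_union_le _ _)
        rw [hD] at this
        exact_mod_cast this
      have h3 : (0 : ℝ) ≤ (1 / 2 : ℝ) ^ #(S i ∩ D) := by positivity
      have h4 : (#Dᶜ : ℝ) - #(Dᶜ.filter (· ∈ S i)) * (1 / 2) ≤ #Dᶜ * (1 - g / 4) := by
        rw [hDc]
        have : (0 : ℝ) ≤ T := by positivity
        nlinarith
      calc _ ≤ (1 / 2 : ℝ) ^ #(S i ∩ D) * (#Dᶜ * (1 - g / 4)) := by gcongr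
        _ = _ := by ring
    obtain ⟨d, hd, hle⟩ := exists_le_of_sum_le (card_pos.1 (by exact_mod_cast hDc0)) hsum
    rw [mem_compl] at hd
    refine ⟨insert d D, by rw [card_insert_of_notMem hd, hD], hle.trans ?_⟩
    calc _ ≤ (1 - g / 4) * (Fintype.card ι * (1 - g / 4) ^ T) := by
          gcongr
          linarith
      _ = _ := by ring

variable {G : SimpleGraph V} [DecidableRel G.Adj]

/-- A small set in which any two vertices still have proportionally many common neighbours. -/
lemma exists_reservoir {g : ℝ} (hg0 : 0 < g) (hg1 : g ≤ 1)
    (hG : CommonNbrsGE G univ (g * Fintype.card V)) (T : ℕ)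
    (hT : (T : ℝ) ≤ g * Fintype.card V / 2)
    (hn : (Fintype.card V : ℝ) ^ 2 ≤ Real.exp (g * T / 8)) :
    ∃ D : Finset V, #D = T ∧ CommonNbrsGE G D (g * T / 8) := by
  obtain ⟨D, hD, hsum⟩ := exists_card_eq_forall_half_pow_le
    (fun p : V × V => commonNbrs G p.1 p.2 univ) hg0 hg1 (fun p => hG p.1 p.2) T hT
  refine ⟨D, hD, fun x y => ?_⟩
  -- One codegree below `g * T / 8` would contribute more than `exp (-g * T / 8)`, whereas the whole
  -- sum is at most `|V| ^ 2 * exp (-g * T / 4)`.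
  by_contra! hlt
  have hD' : commonNbrs G x y univ ∩ D = commonNbrs G x y D := by
    ext z
    simp only [mem_inter, mem_commonNbrs, mem_univ, true_and]
    tauto
  have h1 : (1 / 2 : ℝ) ^ #(commonNbrs G x y D) ≤
      Fintype.card (V × V) * (1 - g / 4) ^ T := by
    refine le_trans ?_ hsum
    have := single_le_sum (f := fun p : V × V => (1 / 2 : ℝ) ^ #(commonNbrs G p.1 p.2 univ ∩ D))
      (fun p _ => by positivity) (mem_univ (x, y))
    rw [← hD']
    exact this
  have h2 : Real.exp (-(#(commonNbrs G x y D) : ℝ)) ≤ (1 / 2 : ℝ) ^ #(commonNbrs G x y D) := by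
    have e : Real.exp (-1) ≤ 1 / 2 := by
      rw [Real.exp_neg, one_div]
      have := Real.exp_one_gt_d9
      gcongr
      linarith
    calc Real.exp (-(#(commonNbrs G x y D) : ℝ)) = Real.exp (-1) ^ #(commonNbrs G x y D) := by
          rw [← Real.exp_nat_mul]; ring_nf
      _ ≤ _ := by gcongr
  have h3 : (1 - g / 4) ^ T ≤ Real.exp (-(g * T / 4)) := by
    have : 1 - g / 4 ≤ Real.exp (-(g / 4)) := by
      have := Real.add_one_le_exp (-(g / 4))
      linarith
    calc (1 - g / 4) ^ T ≤ Real.exp (-(g / 4)) ^ T := by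
          gcongr
          linarith
      _ = _ := by rw [← Real.exp_nat_mul]; ring_nf
  have h4 : (Fintype.card (V × V) : ℝ) = (Fintype.card V : ℝ) ^ 2 := by
    rw [Fintype.card_prod]; push_cast; ring
  rw [h4] at h1
  have h5 : Real.exp (-(g * T / 8)) < Real.exp (-(g * T / 8)) := by
    calc Real.exp (-(g * T / 8)) < Real.exp (-(#(commonNbrs G x y D) : ℝ)) := by
          apply Real.exp_lt_exp.2; linarith
      _ ≤ (Fintype.card V : ℝ) ^ 2 * (1 - g / 4) ^ T := h2.trans h1
      _ ≤ Real.exp (g * T / 8) * Real.exp (-(g * T / 4)) := by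
          gcongr
          have : (0 : ℝ) ≤ 1 - g / 4 := by linarith
          positivity
      _ = _ := by rw [← Real.exp_add]; ring_nf
  exact lt_irrefl _ h5

/-- A short squared path containing all of `D`, from which vertices of `D` may be deleted. -/
lemma exists_absorbing_path {X : Finset (Sym2 V)} {f q g : ℝ} (hX : HitsPopularPairs G X f)
    (hF : Flexible (Fintype.card V) q f) (hG : CommonNbrsGE G univ g) {D : Finset V}
    (hD : D.Nonempty) (hq : q + 11 * #D ≤ g) :
    ∃ P : List V, P.Nodup ∧ P.length ≤ 11 * #D ∧ (∀ x ∈ D, x ∈ P) ∧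
      IsPiece (G.addEdges X) D P := by
  -- Each vertex of `D` costs at most eleven: itself, four for its insertion and six for a
  -- connector.
  have hQ : CommonNbrsGE G (univ \ D) (q + 10 * #D) := (hG.sdiff D).mono (by linarith)
  obtain ⟨K, ps, hK, hKQ, hKl, hpsl, hperm, hps⟩ := exists_insertions (E := D) hX hF D.toList
    (Q := univ \ D) (hQ.mono (by
      rw [length_toList]
      have : (0 : ℝ) ≤ #D := by positivity
      linarith)) (by simp) sdiff_disjoint
  rw [length_toList] at hKl hpsl
  match ps, hpsl with
  | [], hpsl => exact absurd hpsl.symm hD.card_pos.ne'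
  | p :: ps, hpsl =>
  obtain ⟨hpd, a, b, r, c, d, rfl, ha, hb, hc, hd⟩ := hps p List.mem_cons_self
  have hKD : (#K.toFinset : ℝ) ≤ 4 * #D := by
    exact_mod_cast hKl ▸ List.toFinset_card_le K
  have hpsl' : ps.length + 1 = #D := by simpa using hpsl
  have hpslR : (ps.length : ℝ) + 1 = #D := by exact_mod_cast hpsl'
  obtain ⟨K', t, hK', hKQ', hKl', ht, htd, m', c', d', htm, hc', hd'⟩ :=
    exists_chain (m := a :: b :: r) hX hF ps (fun p hp => hps p (List.mem_cons_of_mem _ hp))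
      (Q := (univ \ D) \ K.toFinset) ((hQ.sdiff K.toFinset).mono (by linarith))
      (sdiff_disjoint.mono_left sdiff_subset) hc hd hpd
  set P := (a :: b :: r) ++ [c, d] ++ t with hP
  have hPperm : P.Perm (K' ++ (K ++ D.toList)) := by
    have h1 : P.Perm ((a :: b :: (r ++ [c, d])) ++ (K' ++ ps.flatten)) := by
      rw [hP]
      exact ht.append_left _
    refine h1.trans ?_
    refine (List.perm_append_comm_assoc _ _ _).trans ?_
    exact List.Perm.append_left K' hperm
  refine ⟨P, ?_, ?_, ?_, htd, ?_⟩
  · rw [hPperm.nodup_iff, List.nodup_append', List.nodup_append']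
    refine ⟨hK', ⟨hK, nodup_toList D, fun x hx hx' => ?_⟩, fun x hx hx' => ?_⟩
    · exact (mem_sdiff.1 (hKQ x hx)).2 (mem_toList.1 hx')
    · have := hKQ' x hx
      simp only [mem_sdiff, mem_univ, true_and, List.mem_toFinset] at this
      simp only [List.mem_append, mem_toList] at hx'
      tauto
  · rw [hPperm.length_eq, List.length_append, List.length_append, length_toList, hKl', hKl]
    omega
  · intro x hx
    rw [hPperm.mem_iff]
    simp [hx]
  · have h4 : 4 ≤ P.length := by
      rw [hP]
      simp only [List.cons_append, List.length_cons, List.length_append]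
      simp
      omega
    -- As `P` has at least four entries, splitting off its last pair leaves the first pair `a, b`
    -- intact.
    match m', htm with
    | [], htm =>
      have := congrArg List.length htm
      simp only [List.nil_append, List.length_cons, List.length_nil] at this
      omega
    | [x], htm =>
      have := congrArg List.length htm
      simp only [List.cons_append, List.nil_append, List.length_cons, List.length_nil] at this
      omega
    | x :: y :: m, htm =>
      have h1 : x = a ∧ y = b := by
        rw [hP] at htm
        simp only [List.cons_append, List.cons.injEq] at htm
        exact ⟨htm.1.symm, htm.2.1.symm⟩
      refine ⟨a, b, m, c', d', ?_, ha, hb, hc', hd'⟩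
      rw [htm, h1.1, h1.2]
      simp

/-! ### Squared paths in regular pairs. -/

lemma sum_card_filter_adj_eq (A B : Finset V) :
    ∑ z ∈ B, #(A.filter (G.Adj z)) = #((A ×ˢ B).filter fun p => G.Adj p.1 p.2) := by
  rw [card_filter, sum_product, sum_comm]
  refine sum_congr rfl fun z _ => ?_
  rw [card_filter]
  simp only [G.adj_comm]

lemma sum_card_filter_adj_eq' (A B : Finset V) :
    ∑ z ∈ A, #(B.filter (G.Adj z)) = #((A ×ˢ B).filter fun p => G.Adj p.1 p.2) := by
  rw [card_filter, sum_product]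
  refine sum_congr rfl fun z _ => ?_
  rw [card_filter]

/-- Large subsets of `A` and of `B` span a bipartite graph of density at least `d`. -/
def LowerRegular (G : SimpleGraph V) [DecidableRel G.Adj] (ε d : ℝ) (A B : Finset V) : Prop :=
  ∀ A' ⊆ A, ∀ B' ⊆ B, ε * #A ≤ #A' → ε * #B ≤ #B' →
    d * #A' * #B' ≤ #((A' ×ˢ B').filter fun p => G.Adj p.1 p.2)

/-- Pairs alternate between `A` and `B`, each pair being an edge of `X`. Each one is chosen with at
least `d ^ 2 * μ / 2` common neighbours among the unused vertices of the other side. This set is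
large enough for regularity to apply again, as long as `μ` vertices remain on both sides. -/
lemma exists_squaredPath_of_lowerRegular {X : Finset (Sym2 V)} {f ε d μ : ℝ}
    (hX : HitsPopularPairs G X f) {A B : Finset V} (hAB : Disjoint A B)
    (hreg : LowerRegular G ε d A B) (hd : 0 < d) (hd1 : d ≤ 1) (hμ : 0 < μ)
    (hA : ε * #A ≤ d ^ 2 * μ / 2) (hB : ε * #B ≤ d ^ 2 * μ / 2)
    (hf : f + Fintype.card V ≤ d ^ 2 * (d ^ 2 * μ / 2) ^ 2 / 2) (k : ℕ)
    (hkA : 2 * k + μ ≤ #A) (hkB : 2 * k + μ ≤ #B) :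
    ∃ l : List V, l.Nodup ∧ l.length = 4 * k ∧ (∀ x ∈ l, x ∈ A ∪ B) ∧
      (G.addEdges X).IsSquaredPath l := by
  have hd2 : d ^ 2 ≤ 1 := pow_le_one₀ hd.le hd1
  have hs : d ^ 2 * μ / 2 ≤ μ := by nlinarith
  have hcard : ∀ S : Finset V, (#S : ℝ) ≤ Fintype.card V := fun S => by
    exact_mod_cast card_le_univ S
  have step : ∀ (S C : Finset V), d ^ 2 * μ / 2 ≤ #S → μ ≤ #C →
      d * #S * #C ≤ ∑ z ∈ C, (#(S.filter (G.Adj z)) : ℝ) →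
      ∃ x ∈ S, ∃ y ∈ S, x ≠ y ∧ s(x, y) ∈ X ∧ d ^ 2 * μ / 2 ≤ #(commonNbrs G x y C) := by
    intro S C hS hC hSC
    obtain ⟨x, hx, y, hy, hxy, h1, h2⟩ := hX.exists_edge_of_dense S C
      (card_pos.1 (by exact_mod_cast hμ.trans_le hC)) hd.le hSC (by
        have h1 := hcard S
        have h2 : (d ^ 2 * μ / 2) ^ 2 ≤ (#S : ℝ) ^ 2 := by gcongr
        have h3 : d ^ 2 * (d ^ 2 * μ / 2) ^ 2 ≤ d ^ 2 * (#S : ℝ) ^ 2 := by gcongr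
        linarith)
    refine ⟨x, hx, y, hy, hxy, h1, le_trans ?_ h2⟩
    gcongr
  -- Induction needs a reservoir `S` for the next pair: unused vertices of `A` of which any adjacent
  -- two extend the path. Initially `S = A`.
  suffices h : ∃ (l : List V) (S : Finset V), l.Nodup ∧ l.length = 4 * k ∧
      (∀ x ∈ l, x ∈ A ∪ B) ∧ #(A \ l.toFinset) + 2 * k = #A ∧ #(B \ l.toFinset) + 2 * k = #B ∧
      (G.addEdges X).IsSquaredPath l ∧ S ⊆ A \ l.toFinset ∧ d ^ 2 * μ / 2 ≤ #S ∧
      ∀ a ∈ S, ∀ a' ∈ S, (G.addEdges X).Adj a a' →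
        (G.addEdges X).IsSquaredPath (l ++ [a, a']) by
    obtain ⟨l, S, h1, h2, h3, -, -, h4, -⟩ := h
    exact ⟨l, h1, h2, h3, h4⟩
  induction k with
  | zero =>
    refine ⟨[], A, by simp, by simp, by simp, by simp, by simp, trivial, by simp, ?_, ?_⟩
    · push_cast at hkA
      linarith
    · intro a _ a' _ h
      exact isSquaredPath_pair.2 h
  | succ k ih =>
    push_cast at hkA hkB
    obtain ⟨l, S, hnd, hlen, hmem, hAl, hBl, hsq, hS, hScard, hSsq⟩ :=
      ih (by linarith) (by linarith)
    set A' := A \ l.toFinset with hA'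
    set B' := B \ l.toFinset with hB'
    have hAl' : (#A' : ℝ) + 2 * k = #A := by exact_mod_cast hAl
    have hBl' : (#B' : ℝ) + 2 * k = #B := by exact_mod_cast hBl
    obtain ⟨a, ha, a', ha', haa, haX, hcomB⟩ := step S B' hScard (by linarith) (by
      have h1 := hreg S (hS.trans sdiff_subset) B' sdiff_subset (hA.trans hScard) (by linarith)
      rw [← sum_card_filter_adj_eq] at h1
      exact_mod_cast h1)
    have haA := mem_sdiff.1 (hS ha)
    have haA' := mem_sdiff.1 (hS ha')
    set A'' := A' \ {a, a'} with hA''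
    have hA''card : #A'' + 2 = #A' := by
      rw [hA'', card_sdiff_of_subset (by
        intro x hx
        rw [mem_insert, mem_singleton] at hx
        rcases hx with rfl | rfl
        · exact hS ha
        · exact hS ha'), card_pair haa]
      have : 2 ≤ #A' := by
        rw [← card_pair haa]
        refine card_le_card fun x hx => ?_
        rw [mem_insert, mem_singleton] at hx
        rcases hx with rfl | rfl
        · exact hS ha
        · exact hS ha'
      omega
    have hA''card' : (#A'' : ℝ) + 2 = #A' := by exact_mod_cast hA''card
    obtain ⟨b, hb, b', hb', hbb, hbX, hcomA⟩ := step (commonNbrs G a a' B') A'' hcomB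
      (by linarith) (by
      have h1 := hreg A'' (sdiff_subset.trans sdiff_subset) (commonNbrs G a a' B')
        ((filter_subset _ _).trans sdiff_subset) (by linarith) (hB.trans hcomB)
      rw [← sum_card_filter_adj_eq'] at h1
      have h2 : d * #A'' * #(commonNbrs G a a' B') ≤
          ∑ z ∈ A'', (#((commonNbrs G a a' B').filter (G.Adj z)) : ℝ) := by exact_mod_cast h1
      linarith)
    simp only [mem_commonNbrs, hB', mem_sdiff] at hb hb'
    simp only [List.mem_toFinset] at haA haA' hb hb'
    have hAnB : ∀ x ∈ A, x ∉ B := fun x hx => disjoint_left.1 hAB hx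
    have haaX := adj_addEdges_of_mem (G := G) haX haa
    have hbbX := adj_addEdges_of_mem (G := G) hbX hbb
    have hl2 : (G.addEdges X).IsSquaredPath (l ++ [a, a', b, b']) := by
      refine (hSsq a ha a' ha' haaX).glue ?_
      simp only [isSquaredPath_cons_cons_cons, isSquaredPath_pair]
      exact ⟨haaX, adj_addEdges_of_adj hb.2.1, adj_addEdges_of_adj hb.2.2,
        adj_addEdges_of_adj hb'.2.2, hbbX⟩
    have hAeq : A \ (l ++ [a, a', b, b']).toFinset = A'' := by
      ext x
      simp only [hA'', hA', mem_sdiff, List.mem_toFinset, List.mem_append, List.mem_cons,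
        List.not_mem_nil, or_false, mem_insert, mem_singleton]
      constructor
      · tauto
      · rintro ⟨⟨h1, h2⟩, h3⟩
        have : x ≠ b := fun h => hAnB x h1 (h ▸ hb.1.1)
        have : x ≠ b' := fun h => hAnB x h1 (h ▸ hb'.1.1)
        tauto
    have hBeq : B \ (l ++ [a, a', b, b']).toFinset = B' \ {b, b'} := by
      ext x
      simp only [hB', mem_sdiff, List.mem_toFinset, List.mem_append, List.mem_cons,
        List.not_mem_nil, or_false, mem_insert, mem_singleton]
      constructor
      · tauto
      · rintro ⟨⟨h1, h2⟩, h3⟩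
        have : x ≠ a := fun h => hAnB a haA.1 (h ▸ h1)
        have : x ≠ a' := fun h => hAnB a' haA'.1 (h ▸ h1)
        tauto
    refine ⟨l ++ [a, a', b, b'], commonNbrs G b b' A'', ?_, ?_, ?_, ?_, ?_, hl2, ?_, hcomA, ?_⟩
    · rw [List.nodup_append']
      refine ⟨hnd, ?_, ?_⟩
      · simp only [List.nodup_cons, List.mem_cons, List.not_mem_nil, or_false, not_or,
          not_false_eq_true, List.nodup_nil, and_true]
        exact ⟨⟨haa, hb.2.1.ne, hb'.2.1.ne⟩, ⟨hb.2.2.ne, hb'.2.2.ne⟩, hbb⟩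
      · intro x hx hx'
        simp only [List.mem_cons, List.not_mem_nil, or_false] at hx'
        rcases hx' with rfl | rfl | rfl | rfl
        · exact haA.2 hx
        · exact haA'.2 hx
        · exact hb.1.2 hx
        · exact hb'.1.2 hx
    · rw [List.length_append, hlen]
      simp
      ring
    · intro x hx
      rw [List.mem_append] at hx
      rcases hx with hx | hx
      · exact hmem x hx
      · simp only [List.mem_cons, List.not_mem_nil, or_false] at hx
        rw [mem_union]
        rcases hx with rfl | rfl | rfl | rfl
        · exact Or.inl haA.1
        · exact Or.inl haA'.1
        · exact Or.inr hb.1.1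
        · exact Or.inr hb'.1.1
    · rw [hAeq]
      omega
    · have hsub : ({b, b'} : Finset V) ⊆ B' := by
        intro x hx
        rw [mem_insert, mem_singleton] at hx
        rw [hB', mem_sdiff, List.mem_toFinset]
        rcases hx with rfl | rfl
        · exact hb.1
        · exact hb'.1
      have := card_le_card hsub
      rw [card_pair hbb] at this
      rw [hBeq, card_sdiff_of_subset hsub, card_pair hbb]
      omega
    · rw [hAeq]
      exact filter_subset _ _
    · intro x hx y hy hxy
      rw [mem_commonNbrs] at hx hy
      have h2 : (G.addEdges X).IsSquaredPath ((l ++ [a, a']) ++ b :: b' :: [x, y]) := by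
        refine IsSquaredPath.glue (by simpa using hl2) ?_
        simp only [isSquaredPath_cons_cons_cons, isSquaredPath_pair]
        exact ⟨hbbX, adj_addEdges_of_adj hx.2.1, adj_addEdges_of_adj hx.2.2,
          adj_addEdges_of_adj hy.2.2, hxy⟩
      simpa using h2

end

/-! ### Almost covering by regular pairs. -/

section
open Finset SimpleGraph

set_option linter.unusedSectionVars false

/-- A maximum matching of `Γ` leaves an uncovered set that sends few edges out. -/
lemma exists_matching_edges_le {ι : Type*} [DecidableEq ι] (Γ : SimpleGraph ι)
    [DecidableRel Γ.Adj] (R : Finset ι) :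
    ∃ 𝓜 : Finset (ι × ι), (∀ p ∈ 𝓜, p.1 ∈ R ∧ p.2 ∈ R ∧ Γ.Adj p.1 p.2) ∧
      (∀ p ∈ 𝓜, ∀ q ∈ 𝓜, p ≠ q → Disjoint ({p.1, p.2} : Finset ι) {q.1, q.2}) ∧
      2 * #𝓜 ≤ #R ∧
      (2 ≤ #(R \ 𝓜.biUnion fun p => {p.1, p.2}) →
        2 * #(((R \ 𝓜.biUnion fun p => {p.1, p.2}) ×ˢ R).filter fun p => Γ.Adj p.1 p.2) ≤
          #(R \ 𝓜.biUnion fun p => {p.1, p.2}) * #R) := by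
  let good : Finset (ι × ι) → Prop := fun 𝓜 =>
    (∀ p ∈ 𝓜, p.1 ∈ R ∧ p.2 ∈ R ∧ Γ.Adj p.1 p.2) ∧
      (∀ p ∈ 𝓜, ∀ q ∈ 𝓜, p ≠ q → Disjoint ({p.1, p.2} : Finset ι) {q.1, q.2})
  obtain ⟨𝓜, hgood, hmax⟩ : ∃ 𝓜, good 𝓜 ∧ ∀ 𝓝, good 𝓝 → #𝓝 ≤ #𝓜 := by
    classical
    obtain ⟨𝓜, h𝓜, hmax⟩ := exists_max_image ((R ×ˢ R).powerset.filter good) card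
      ⟨∅, by simp [good]⟩
    refine ⟨𝓜, (mem_filter.1 h𝓜).2, fun 𝓝 h𝓝 => hmax 𝓝 (mem_filter.2 ⟨?_, h𝓝⟩)⟩
    rw [mem_powerset]
    intro p hp
    exact mem_product.2 ⟨(h𝓝.1 p hp).1, (h𝓝.1 p hp).2.1⟩
  obtain ⟨h1, h2⟩ := hgood
  set C := 𝓜.biUnion fun p => ({p.1, p.2} : Finset ι) with hC
  have hmemC : ∀ p ∈ 𝓜, p.1 ∈ C ∧ p.2 ∈ C := fun p hp =>
    ⟨mem_biUnion.2 ⟨p, hp, by simp⟩, mem_biUnion.2 ⟨p, hp, by simp⟩⟩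
  have hCR : C ⊆ R := by
    intro x hx
    obtain ⟨p, hp, hxp⟩ := mem_biUnion.1 hx
    rw [mem_insert, mem_singleton] at hxp
    rcases hxp with rfl | rfl
    · exact (h1 p hp).1
    · exact (h1 p hp).2.1
  have hCcard : #C = 2 * #𝓜 := by
    rw [hC, card_biUnion (fun p hp q hq hpq => h2 p hp q hq hpq)]
    rw [sum_congr rfl fun p hp => card_pair (h1 p hp).2.2.ne, sum_const, smul_eq_mul, mul_comm]
  have hU : ∀ x ∈ R \ C, ∀ y ∈ R \ C, ¬ Γ.Adj x y := by
    intro x hx y hy hxy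
    rw [mem_sdiff] at hx hy
    have hnot : (x, y) ∉ 𝓜 := fun h => hx.2 (hmemC _ h).1
    have := hmax (insert (x, y) 𝓜) ⟨?_, ?_⟩
    · rw [card_insert_of_notMem hnot] at this
      omega
    · intro p hp
      rcases mem_insert.1 hp with rfl | hp
      · exact ⟨hx.1, hy.1, hxy⟩
      · exact h1 p hp
    · have hd : ∀ p ∈ 𝓜, Disjoint ({x, y} : Finset ι) {p.1, p.2} := by
        intro p hp
        rw [Finset.disjoint_left]
        intro z hz hz'
        have hzC : z ∈ C := mem_biUnion.2 ⟨p, hp, hz'⟩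
        rw [mem_insert, mem_singleton] at hz
        rcases hz with rfl | rfl
        · exact hx.2 hzC
        · exact hy.2 hzC
      intro p hp q hq hpq
      rcases mem_insert.1 hp with rfl | hp <;> rcases mem_insert.1 hq with rfl | hq
      · exact absurd rfl hpq
      · exact hd q hq
      · exact (hd p hp).symm
      · exact h2 p hp q hq hpq
  -- Otherwise `x, p.1, p.2, y` is an augmenting path.
  have haug : ∀ p ∈ 𝓜, ∀ x ∈ R \ C, ∀ y ∈ R \ C, Γ.Adj x p.1 → Γ.Adj y p.2 → x = y := by
    intro p hp x hx y hy hxp hyp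
    by_contra hxy
    rw [mem_sdiff] at hx hy
    have hpC := hmemC p hp
    have hd : ∀ q ∈ 𝓜.erase p, ∀ z ∈ ({q.1, q.2} : Finset ι), z ≠ x ∧ z ≠ y ∧ z ≠ p.1 ∧
        z ≠ p.2 := by
      intro q hq z hz
      rw [mem_erase] at hq
      have hzC : z ∈ C := mem_biUnion.2 ⟨q, hq.2, hz⟩
      have hdis := Finset.disjoint_left.1 (h2 q hq.2 p hp hq.1) hz
      rw [mem_insert, mem_singleton, not_or] at hdis
      exact ⟨fun h => hx.2 (h ▸ hzC), fun h => hy.2 (h ▸ hzC), hdis.1, hdis.2⟩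
    have hn1 : (y, p.2) ∉ 𝓜.erase p := fun h => hy.2 (hmemC _ (mem_of_mem_erase h)).1
    have hn2 : (x, p.1) ∉ insert (y, p.2) (𝓜.erase p) := by
      rw [mem_insert, not_or]
      exact ⟨fun h => hxy (Prod.ext_iff.1 h).1, fun h => hx.2 (hmemC _ (mem_of_mem_erase h)).1⟩
    have hne : p.1 ≠ p.2 := (h1 p hp).2.2.ne
    have hx2 : x ≠ p.2 := fun h => hx.2 (h ▸ hpC.2)
    have hy1 : y ≠ p.1 := fun h => hy.2 (h ▸ hpC.1)
    have := hmax (insert (x, p.1) (insert (y, p.2) (𝓜.erase p))) ⟨?_, ?_⟩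
    · rw [card_insert_of_notMem hn2, card_insert_of_notMem hn1, card_erase_of_mem hp] at this
      have := card_pos.2 ⟨p, hp⟩
      omega
    · intro q hq
      rcases mem_insert.1 hq with rfl | hq
      · exact ⟨hx.1, (h1 p hp).1, hxp⟩
      rcases mem_insert.1 hq with rfl | hq
      · exact ⟨hy.1, (h1 p hp).2.1, hyp⟩
      · exact h1 q (mem_of_mem_erase hq)
    · have hdx : ∀ q ∈ 𝓜.erase p, Disjoint ({x, p.1} : Finset ι) {q.1, q.2} := by
        intro q hq
        rw [Finset.disjoint_right]
        intro z hz
        have := hd q hq z hz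
        rw [mem_insert, mem_singleton]
        tauto
      have hdy : ∀ q ∈ 𝓜.erase p, Disjoint ({y, p.2} : Finset ι) {q.1, q.2} := by
        intro q hq
        rw [Finset.disjoint_right]
        intro z hz
        have := hd q hq z hz
        rw [mem_insert, mem_singleton]
        tauto
      have hdxy : Disjoint ({x, p.1} : Finset ι) {y, p.2} := by
        simp [Ne.symm hxy, hne.symm, hx2.symm, hy1]
      intro q hq r hr hqr
      rcases mem_insert.1 hq with rfl | hq <;> rcases mem_insert.1 hr with rfl | hr
      · exact absurd rfl hqr
      · rcases mem_insert.1 hr with rfl | hr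
        · exact hdxy
        · exact hdx r hr
      · rcases mem_insert.1 hq with rfl | hq
        · exact hdxy.symm
        · exact (hdx q hq).symm
      · rcases mem_insert.1 hq with rfl | hq <;> rcases mem_insert.1 hr with rfl | hr
        · exact absurd rfl hqr
        · exact hdy r hr
        · exact (hdy q hq).symm
        · exact h2 q (mem_of_mem_erase hq) r (mem_of_mem_erase hr) hqr
  have hM2 : 2 * #𝓜 ≤ #R := hCcard ▸ card_le_card hCR
  refine ⟨𝓜, h1, h2, hM2, fun hU2 => ?_⟩
  replace hU2 : 2 ≤ #(R \ C) := hU2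
  -- If both ends of `p` have uncovered neighbours, `haug` leaves each end just one, a total of `2`;
  -- this is where at least two uncovered vertices are needed.
  have hpair : ∀ p ∈ 𝓜, #((R \ C).filter fun x => Γ.Adj x p.1) +
      #((R \ C).filter fun x => Γ.Adj x p.2) ≤ #(R \ C) := by
    intro p hp
    rcases eq_empty_or_nonempty ((R \ C).filter fun x => Γ.Adj x p.1) with h | ⟨x, hx⟩
    · rw [h, card_empty, zero_add]
      exact card_filter_le _ _
    rcases eq_empty_or_nonempty ((R \ C).filter fun x => Γ.Adj x p.2) with h | ⟨y, hy⟩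
    · rw [h, card_empty, add_zero]
      exact card_filter_le _ _
    rw [mem_filter] at hx hy
    have e1 : #((R \ C).filter fun x => Γ.Adj x p.1) ≤ 1 := by
      rw [card_le_one]
      intro u hu v hv
      rw [mem_filter] at hu hv
      rw [haug p hp u hu.1 y hy.1 hu.2 hy.2, haug p hp v hv.1 y hy.1 hv.2 hy.2]
    have e2 : #((R \ C).filter fun x => Γ.Adj x p.2) ≤ 1 := by
      rw [card_le_one]
      intro u hu v hv
      rw [mem_filter] at hu hv
      rw [← haug p hp x hx.1 u hu.1 hx.2 hu.2, ← haug p hp x hx.1 v hv.1 hx.2 hv.2]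
    omega
  have hcount : #(((R \ C) ×ˢ R).filter fun p => Γ.Adj p.1 p.2) ≤ #𝓜 * #(R \ C) := by
    rw [card_filter, sum_product_right]
    calc ∑ y ∈ R, ∑ x ∈ R \ C, (if Γ.Adj x y then 1 else 0)
        = ∑ y ∈ C, ∑ x ∈ R \ C, (if Γ.Adj x y then 1 else 0) := by
          refine (sum_subset hCR fun y hy hyC => ?_).symm
          refine sum_eq_zero fun x hx => ?_
          rw [if_neg (hU x hx y (mem_sdiff.2 ⟨hy, hyC⟩))]
      _ = ∑ p ∈ 𝓜, ∑ y ∈ ({p.1, p.2} : Finset ι), ∑ x ∈ R \ C, (if Γ.Adj x y then 1 else 0) :=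
          sum_biUnion fun p hp q hq hpq => h2 p hp q hq hpq
      _ ≤ ∑ p ∈ 𝓜, #(R \ C) := by
          refine sum_le_sum fun p hp => ?_
          rw [sum_pair (h1 p hp).2.2.ne, ← card_filter, ← card_filter]
          exact hpair p hp
      _ = #𝓜 * #(R \ C) := by rw [sum_const, smul_eq_mul]
  calc _ ≤ 2 * (#𝓜 * #(R \ C)) := Nat.mul_le_mul_left 2 hcount
    _ = #(R \ C) * (2 * #𝓜) := by ring
    _ ≤ _ := Nat.mul_le_mul_left _ hM2

set_option maxHeartbeats 1000000 in
/-- Szemerédi's regularity lemma gives, in a graph of minimum degree above half, boundedly many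
dense regular pairs covering almost all vertices. -/
lemma exists_lowerRegular_cover {γ β ε : ℝ} (hγ : 0 < γ) (hγ1 : γ ≤ 1 / 2) (hβ : 0 < β)
    (hε : 0 < ε) (hεγ : ε ≤ γ / 8) (hεβ : ε ≤ γ * β / 16) :
    ∃ M N : ℕ, 0 < M ∧ ∀ (U : Type) [Fintype U] [DecidableEq U] (G : SimpleGraph U)
      [DecidableRel G.Adj], N ≤ Fintype.card U →
      (∀ v, (1 / 2 + γ) * Fintype.card U ≤ G.degree v) →
      ∃ 𝓜 : Finset (Finset U × Finset U), #𝓜 ≤ M ∧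
        (∀ p ∈ 𝓜, Disjoint p.1 p.2 ∧ LowerRegular G ε (γ / 8) p.1 p.2 ∧
          ∃ s : ℕ, Fintype.card U ≤ 2 * M * s ∧ s ≤ #p.1 ∧ s ≤ #p.2 ∧ #p.1 ≤ s + 1 ∧
            #p.2 ≤ s + 1) ∧
        (∀ p ∈ 𝓜, ∀ q ∈ 𝓜, p ≠ q → Disjoint (p.1 ∪ p.2) (q.1 ∪ q.2)) ∧
        (#(univ \ 𝓜.biUnion fun p => p.1 ∪ p.2) : ℝ) ≤ β * Fintype.card U := by
  classical
  -- At least `8/γ` parts make the diagonal pairs negligible; at least `2/β` parts ensure that more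
  -- than `β/2 * k` uncovered parts are at least two.
  set L : ℕ := ⌈8 / γ⌉₊ + ⌈2 / β⌉₊ with hL
  set M := SzemerediRegularity.bound ε L with hM
  have hMpos : 0 < M := SzemerediRegularity.bound_pos _ _
  have hLM : L ≤ M := SzemerediRegularity.le_bound _ _
  refine ⟨M, M * (⌈6 / γ⌉₊ + 2), hMpos, fun U _ _ G _ hU hdeg => ?_⟩
  set n := Fintype.card U with hn
  obtain ⟨P, hPeq, hPL, hPM, hPu⟩ := szemeredi_regularity G (l := L) hε (by
    refine hLM.trans (le_trans ?_ hU)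
    exact Nat.le_mul_of_pos_right _ (by omega))
  set k := #P.parts with hk
  have hLγ : 8 / γ ≤ k := by
    refine (Nat.le_ceil _).trans ?_
    exact_mod_cast (Nat.le_add_right _ _).trans hPL
  have hLβ : 2 / β ≤ k := by
    refine (Nat.le_ceil _).trans ?_
    exact_mod_cast (Nat.le_add_left _ _).trans hPL
  have hk0 : (0 : ℝ) < k := lt_of_lt_of_le (by positivity) hLγ
  have hkpos : 0 < k := by exact_mod_cast hk0
  set s := n / k with hs
  have hs1 : ⌈6 / γ⌉₊ + 2 ≤ s := by
    rw [hs, Nat.le_div_iff_mul_le hkpos]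
    calc _ ≤ (⌈6 / γ⌉₊ + 2) * M := Nat.mul_le_mul_left _ hPM
      _ = M * (⌈6 / γ⌉₊ + 2) := mul_comm _ _
      _ ≤ n := hU
  have hs2 : 6 / γ + 1 ≤ (s : ℝ) := by
    have h1 := Nat.le_ceil (6 / γ)
    have h2 : ((⌈6 / γ⌉₊ : ℕ) : ℝ) + 2 ≤ s := by exact_mod_cast hs1
    linarith
  have hs3 : (1 : ℝ) ≤ s := by
    have : 0 < 6 / γ := by positivity
    linarith
  have hsn : k * s ≤ n := Nat.mul_div_le n k
  have hsn' : n ≤ k * (s + 1) := (Nat.lt_mul_div_succ n hkpos).le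
  have hlow : ∀ C ∈ P.parts, s ≤ #C := fun C hC => hPeq.average_le_card_part hC
  have hhigh : ∀ C ∈ P.parts, #C ≤ s + 1 := fun C hC => hPeq.card_part_le_average_add_one hC
  -- The reduced graph: regular pairs of density at least `γ / 4`.
  let Γ : SimpleGraph (Finset U) :=
    { Adj := fun A B => A ≠ B ∧ G.IsUniform ε A B ∧ γ / 4 ≤ (G.edgeDensity A B : ℝ)
      symm := ⟨fun A B h => ⟨h.1.symm, h.2.1.symm, by rw [edgeDensity_comm]; exact h.2.2⟩⟩
      loopless := ⟨fun A h => h.1 rfl⟩ }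
  obtain ⟨𝓜, h1, h2, h3, h4⟩ := exists_matching_edges_le Γ P.parts
  set C := 𝓜.biUnion fun p => ({p.1, p.2} : Finset (Finset U)) with hC
  set R := P.parts \ C with hR
  have hdisj : ∀ A ∈ P.parts, ∀ B ∈ P.parts, A ≠ B → Disjoint A B := fun A hA B hB hAB =>
    P.disjoint hA hB hAB
  -- Edges of `G` leaving the uncovered parts are counted twice. The degrees give density `1/2 + γ`.
  -- The matching bound gives `1/2`, plus `γ/8` for irregular pairs, `γ/8` for the diagonal and
  -- `γ/4` for sparse pairs. Part sizes `s ≥ 6/γ + 1` absorb the rounding from `s` to `s + 1`.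
  have hRbound : (#R : ℝ) ≤ β / 2 * k := by
    by_contra! hlt
    have hone : 1 ≤ β / 2 * k := by
      calc (1 : ℝ) = β / 2 * (2 / β) := by field_simp
        _ ≤ _ := by gcongr
    have hR1 : (1 : ℝ) < #R := hone.trans_lt hlt
    have hR2 : 2 ≤ #R := by exact_mod_cast hR1
    have hΓ := h4 hR2
    have hlower : (#R : ℝ) * ((1 / 2 + γ) * n * s) ≤
        ∑ p ∈ R ×ˢ P.parts, (#(G.interedges p.1 p.2) : ℝ) := by
      rw [sum_product, ← nsmul_eq_mul]
      refine card_nsmul_le_sum _ _ _ fun A hA => ?_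
      have hA' : A ∈ P.parts := (mem_sdiff.1 hA).1
      have e1 : #(G.interedges A univ) = ∑ B ∈ P.parts, #(G.interedges A B) :=
        Rel.card_interedges_finpartition_right _ A P
      have e2 : #(G.interedges A univ) = ∑ v ∈ A, G.degree v := by
        rw [interedges_def, ← sum_card_filter_adj_eq']
        refine sum_congr rfl fun v _ => ?_
        rw [← card_neighborFinset_eq_degree, neighborFinset_eq_filter]
      have e3 : (∑ B ∈ P.parts, (#(G.interedges A B) : ℝ)) = ∑ v ∈ A, (G.degree v : ℝ) := by
        exact_mod_cast e1.symm.trans e2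
      rw [e3]
      calc (1 / 2 + γ) * n * s ≤ (1 / 2 + γ) * n * #A := by
            gcongr
            exact_mod_cast hlow A hA'
        _ = #A • ((1 / 2 + γ) * n) := by rw [nsmul_eq_mul]; ring
        _ ≤ _ := card_nsmul_le_sum _ _ _ fun v _ => hdeg v
    have hpt : ∀ p ∈ R ×ˢ P.parts, (#(G.interedges p.1 p.2) : ℝ) ≤
        ((s : ℝ) + 1) ^ 2 * ((if Γ.Adj p.1 p.2 then 1 else 0) +
          (if p ∈ P.nonUniforms G ε then 1 else 0) + (if p.1 = p.2 then 1 else 0) + γ / 4) := by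
      rintro ⟨A, B⟩ hp
      rw [mem_product] at hp
      have hA : A ∈ P.parts := (mem_sdiff.1 hp.1).1
      have hB : B ∈ P.parts := hp.2
      have hAs : (#A : ℝ) ≤ s + 1 := by exact_mod_cast hhigh A hA
      have hBs : (#B : ℝ) ≤ s + 1 := by exact_mod_cast hhigh B hB
      have hABs : (#A : ℝ) * #B ≤ (s + 1) ^ 2 := by
        rw [sq]
        gcongr
      have htriv : (#(G.interedges A B) : ℝ) ≤ ((s : ℝ) + 1) ^ 2 :=
        le_trans (by exact_mod_cast G.card_interedges_le_mul A B) hABs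
      have hγ4 : 0 ≤ γ / 4 := by positivity
      have hbig : ∀ x : ℝ, 1 ≤ x → (#(G.interedges A B) : ℝ) ≤ ((s : ℝ) + 1) ^ 2 * x := by
        intro x hx
        refine htriv.trans ?_
        have : (0 : ℝ) ≤ (s + 1) ^ 2 := by positivity
        nlinarith
      by_cases c1 : Γ.Adj A B
      · apply hbig
        rw [if_pos c1]
        split_ifs
        all_goals linarith
      by_cases c2 : (A, B) ∈ P.nonUniforms G ε
      · apply hbig
        rw [if_pos c2]
        split_ifs
        all_goals linarith
      by_cases c3 : A = B
      · apply hbig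
        simp only [if_pos c3]
        split_ifs
        all_goals linarith
      simp only [if_neg c1, if_neg c2, if_neg c3]
      have hun : G.IsUniform ε A B := by
        by_contra h
        exact c2 ((P.mk_mem_nonUniforms G).2 ⟨hA, hB, c3, h⟩)
      have hden : (G.edgeDensity A B : ℝ) < γ / 4 := by
        by_contra! h
        exact c1 ⟨c3, hun, h⟩
      have hAB0 : (0 : ℝ) < #A * #B := by
        have a1 : (0 : ℝ) < #A := by exact_mod_cast (P.nonempty_of_mem_parts hA).card_pos
        have a2 : (0 : ℝ) < #B := by exact_mod_cast (P.nonempty_of_mem_parts hB).card_pos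
        positivity
      have hden' : (#(G.interedges A B) : ℝ) / (#A * #B) < γ / 4 := by
        rw [edgeDensity_def] at hden
        push_cast at hden
        exact hden
      rw [div_lt_iff₀ hAB0] at hden'
      calc _ ≤ γ / 4 * (#A * #B) := hden'.le
        _ ≤ γ / 4 * (s + 1) ^ 2 := by gcongr
        _ = _ := by ring
    have hupper : ∑ p ∈ R ×ˢ P.parts, (#(G.interedges p.1 p.2) : ℝ) ≤
        ((s : ℝ) + 1) ^ 2 * (#R * k / 2 + ε * k ^ 2 + #R + γ / 4 * (#R * k)) := by
      refine (sum_le_sum hpt).trans ?_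
      rw [← mul_sum]
      gcongr
      rw [sum_add_distrib, sum_add_distrib, sum_add_distrib]
      have t1 : ∑ p ∈ R ×ˢ P.parts, (if Γ.Adj p.1 p.2 then (1 : ℝ) else 0) ≤ #R * k / 2 := by
        rw [sum_boole, le_div_iff₀ (by norm_num), mul_comm]
        exact_mod_cast hΓ
      have t2 : ∑ p ∈ R ×ˢ P.parts, (if p ∈ P.nonUniforms G ε then (1 : ℝ) else 0) ≤
          ε * k ^ 2 := by
        rw [sum_boole]
        have hPu' : (#(P.nonUniforms G ε) : ℝ) ≤ ((k * (k - 1) : ℕ) : ℝ) * ε := hPu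
        have e1 : ((k * (k - 1) : ℕ) : ℝ) ≤ (k : ℝ) ^ 2 := by
          have : k * (k - 1) ≤ k ^ 2 := by
            rw [sq]
            exact Nat.mul_le_mul_left _ (Nat.sub_le _ _)
          exact_mod_cast this
        have e2 : (#((R ×ˢ P.parts).filter fun p => p ∈ P.nonUniforms G ε) : ℝ) ≤
            #(P.nonUniforms G ε) := by
          exact_mod_cast card_le_card fun p hp => (mem_filter.1 hp).2
        nlinarith
      have t3 : ∑ p ∈ R ×ˢ P.parts, (if p.1 = p.2 then (1 : ℝ) else 0) ≤ #R := by
        rw [sum_boole]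
        have : (R ×ˢ P.parts).filter (fun p => p.1 = p.2) ⊆ R.diag := by
          intro p hp
          rw [mem_filter, mem_product] at hp
          exact mem_diag.2 ⟨hp.1.1, hp.2⟩
        have := card_le_card this
        rw [diag_card] at this
        exact_mod_cast this
      have t4 : ∑ p ∈ R ×ˢ P.parts, (γ / 4 : ℝ) = γ / 4 * (#R * k) := by
        rw [sum_const, card_product, nsmul_eq_mul]
        push_cast
        ring
      linarith
    have hmain := hlower.trans hupper
    have hsnR : (k : ℝ) * s ≤ n := by exact_mod_cast hsn
    have b1 : (#R : ℝ) * k * ((1 / 2 + γ) * s ^ 2) ≤ #R * ((1 / 2 + γ) * n * s) := by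
      calc (#R : ℝ) * k * ((1 / 2 + γ) * s ^ 2) = #R * ((1 / 2 + γ) * (k * s) * s) := by ring
        _ ≤ _ := by gcongr
    have b2 : ε * (k : ℝ) ^ 2 ≤ γ / 8 * (#R * k) := by
      have : ε * k ≤ γ / 8 * #R := by
        calc ε * k ≤ γ * β / 16 * k := by gcongr
          _ = γ / 8 * (β / 2 * k) := by ring
          _ ≤ _ := by gcongr
      calc ε * (k : ℝ) ^ 2 = (ε * k) * k := by ring
        _ ≤ (γ / 8 * #R) * k := by gcongr
        _ = _ := by ring
    have b3 : (#R : ℝ) ≤ γ / 8 * (#R * k) := by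
      have : 1 ≤ γ / 8 * k := by
        calc (1 : ℝ) = γ / 8 * (8 / γ) := by field_simp
          _ ≤ _ := by gcongr
      nlinarith
    have b4 : #R * k / 2 + ε * k ^ 2 + #R + γ / 4 * (#R * k) ≤
        (#R : ℝ) * k * (1 / 2 + γ / 2) := by linarith
    have b5 : (#R : ℝ) * k * ((1 / 2 + γ) * s ^ 2) ≤
        (#R : ℝ) * k * ((s + 1) ^ 2 * (1 / 2 + γ / 2)) := by
      calc _ ≤ ((s : ℝ) + 1) ^ 2 * (#R * k / 2 + ε * k ^ 2 + #R + γ / 4 * (#R * k)) :=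
            b1.trans hmain
        _ ≤ ((s : ℝ) + 1) ^ 2 * ((#R : ℝ) * k * (1 / 2 + γ / 2)) := by gcongr
        _ = _ := by ring
    have b6 : (1 / 2 + γ) * (s : ℝ) ^ 2 ≤ (s + 1) ^ 2 * (1 / 2 + γ / 2) :=
      le_of_mul_le_mul_left b5 (by positivity)
    have b7 : 6 + γ ≤ γ * s := by
      calc 6 + γ = γ * (6 / γ + 1) := by field_simp
        _ ≤ _ := by gcongr
    nlinarith
  refine ⟨𝓜, ?_, ?_, ?_, ?_⟩
  · omega
  · intro p hp
    obtain ⟨hp1, hp2, hne, hun, hden⟩ := h1 p hp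
    refine ⟨hdisj _ hp1 _ hp2 hne, ?_, s, ?_, hlow _ hp1, hlow _ hp2, hhigh _ hp1,
      hhigh _ hp2⟩
    · intro A hA B hB hAc hBc
      rcases A.eq_empty_or_nonempty with rfl | hA0
      · simp
      rcases B.eq_empty_or_nonempty with rfl | hB0
      · simp
      -- Regularity moves the density, at least `γ / 4`, by less than `ε ≤ γ / 8`.
      have hu := hun hA hB (by rwa [mul_comm]) (by rwa [mul_comm])
      have hd : γ / 8 ≤ (G.edgeDensity A B : ℝ) := by
        have := (abs_lt.1 hu).1
        linarith
      have hAB0 : (0 : ℝ) < #A * #B := by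
        have a1 : (0 : ℝ) < #A := by exact_mod_cast hA0.card_pos
        have a2 : (0 : ℝ) < #B := by exact_mod_cast hB0.card_pos
        positivity
      rw [edgeDensity_def] at hd
      push_cast at hd
      rw [le_div_iff₀ hAB0] at hd
      rw [mul_assoc]
      exact hd
    · calc n ≤ k * (s + 1) := hsn'
        _ ≤ M * (2 * s) := Nat.mul_le_mul hPM (by omega)
        _ = 2 * M * s := by ring
  · intro p hp q hq hpq
    obtain ⟨hp1, hp2, -⟩ := h1 p hp
    obtain ⟨hq1, hq2, -⟩ := h1 q hq
    have hd := h2 p hp q hq hpq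
    simp only [Finset.disjoint_insert_left, Finset.disjoint_singleton_left, mem_insert,
      mem_singleton, not_or] at hd
    rw [disjoint_union_left, disjoint_union_right, disjoint_union_right]
    exact ⟨⟨hdisj _ hp1 _ hq1 hd.1.1, hdisj _ hp1 _ hq2 hd.1.2⟩,
      hdisj _ hp2 _ hq1 hd.2.1, hdisj _ hp2 _ hq2 hd.2.2⟩
  · have hsub : univ \ (𝓜.biUnion fun p => p.1 ∪ p.2) ⊆ R.biUnion id := by
      intro v hv
      rw [mem_sdiff] at hv
      obtain ⟨A, hA, hvA⟩ := P.exists_mem (mem_univ v)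
      refine mem_biUnion.2 ⟨A, mem_sdiff.2 ⟨hA, fun hAC => hv.2 ?_⟩, hvA⟩
      obtain ⟨p, hp, hAp⟩ := mem_biUnion.1 hAC
      refine mem_biUnion.2 ⟨p, hp, ?_⟩
      rw [mem_insert, mem_singleton] at hAp
      rw [mem_union]
      rcases hAp with rfl | rfl
      · exact Or.inl hvA
      · exact Or.inr hvA
    have hcard : #(univ \ (𝓜.biUnion fun p => p.1 ∪ p.2)) ≤ #R * (s + 1) :=
      (card_le_card hsub).trans (card_biUnion_le_card_mul _ _ _ fun A hA =>
        hhigh A (mem_sdiff.1 hA).1)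
    have hcard' : (#(univ \ (𝓜.biUnion fun p => p.1 ∪ p.2)) : ℝ) ≤ #R * (s + 1) := by
      exact_mod_cast hcard
    have hsnR : (k : ℝ) * s ≤ n := by exact_mod_cast hsn
    calc _ ≤ (#R : ℝ) * (s + 1) := hcard'
      _ ≤ (β / 2 * k) * (2 * s) := by
          gcongr
          linarith
      _ = β * (k * s) := by ring
      _ ≤ β * n := by gcongr

end

/-! ### Almost covering by squared paths, and closing the cycle. -/

section
open Finset SimpleGraph

set_option linter.unusedSectionVars false

lemma LowerRegular.map {V : Type*} [DecidableEq V] {G : SimpleGraph V} [DecidableRel G.Adj]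
    {W : Finset V} [DecidableRel (G.comap (Subtype.val : {x // x ∈ W} → V)).Adj] {ε d : ℝ}
    {A B : Finset {x // x ∈ W}} (h : LowerRegular (G.comap Subtype.val) ε d A B) :
    LowerRegular G ε d (A.map (Function.Embedding.subtype _))
      (B.map (Function.Embedding.subtype _)) := by
  intro A' hA B' hB hAc hBc
  obtain ⟨A', hA', rfl⟩ := subset_map_iff.1 hA
  obtain ⟨B', hB', rfl⟩ := subset_map_iff.1 hB
  simp only [card_map] at hAc hBc ⊢
  refine (h A' hA' B' hB' hAc hBc).trans (le_of_eq ?_)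
  congr 1
  rw [← prodMap_map_product, filter_map, card_map]
  congr 1
  ext x
  rw [mem_filter, mem_filter]
  exact Iff.rfl

/-- In a set inducing minimum degree above half, boundedly many squared paths cover almost
everything. -/
lemma exists_squaredPath_cover {γ β : ℝ} (hγ : 0 < γ) (hγ1 : γ ≤ 1 / 2) (hβ : 0 < β)
    (hβ1 : β ≤ 1) :
    ∃ (M N : ℕ) (c : ℝ), 0 < c ∧ ∀ (V : Type) [Fintype V] [DecidableEq V] (G : SimpleGraph V)
      [DecidableRel G.Adj] (X : Finset (Sym2 V)) (f : ℝ) (W : Finset V), N ≤ #W →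
      (∀ v ∈ W, (1 / 2 + γ) * #W ≤ #(W.filter (G.Adj v))) → HitsPopularPairs G X f →
      f + Fintype.card V ≤ c * (#W : ℝ) ^ 2 →
      ∃ ps : List (List V), ps.length ≤ M ∧
        (∀ p ∈ ps, 4 ≤ p.length ∧ (G.addEdges X).IsSquaredPath p) ∧ ps.flatten.Nodup ∧
        (∀ x ∈ ps.flatten, x ∈ W) ∧ (#(W \ ps.flatten.toFinset) : ℝ) ≤ β * #W := by
  classical
  set d := γ / 8 with hd
  set τ := β / 4 with hτ
  have hd0 : 0 < d := by positivity
  have hτ0 : 0 < τ := by positivity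
  -- The last term gives `ε * (s + 1) ≤ d ^ 2 * μ / 2` for `μ = τ * s` and parts of size at most `s
  -- + 1`.
  set ε := min (min (γ / 8) (γ * (β / 2) / 16)) (d ^ 2 * τ / 4) with hε
  have hε0 : 0 < ε := by positivity
  obtain ⟨M, N, hM, hreg⟩ := exists_lowerRegular_cover (β := β / 2) (ε := ε) hγ hγ1 (by positivity)
    hε0 ((min_le_left _ _).trans (min_le_left _ _)) ((min_le_left _ _).trans (min_le_right _ _))
  have hM0 : (0 : ℝ) < M := by exact_mod_cast hM
  -- `8 * M` forces `s ≥ 4`, and `24 * M / β` makes the rounding loss `6 * M` at most `β / 4 * #W`.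
  -- The constant comes from `s ≥ #W / (2 * M)`.
  refine ⟨M, max N (max (8 * M) ⌈24 * M / β⌉₊), d ^ 2 * (d ^ 2 * τ / (4 * M)) ^ 2 / 2,
    by positivity, ?_⟩
  intro V _ _ G _ X f W hW hdeg hX hf
  have hWN : N ≤ #W := (le_max_left _ _).trans hW
  have hWM : 8 * M ≤ #W := (le_max_left _ _).trans ((le_max_right _ _).trans hW)
  have hWβ : 6 * (M : ℝ) ≤ β / 4 * #W := by
    have h1 : 24 * M / β ≤ #W := (Nat.le_ceil _).trans (by
      exact_mod_cast (le_max_right _ _).trans ((le_max_right _ _).trans hW))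
    calc 6 * (M : ℝ) = β / 4 * (24 * M / β) := by field_simp; norm_num
      _ ≤ _ := by gcongr
  let e : {x // x ∈ W} ↪ V := Function.Embedding.subtype _
  have hcardU : Fintype.card {x // x ∈ W} = #W := Fintype.card_coe W
  obtain ⟨𝓜, h𝓜, hpairs, hdisj, hcov⟩ := hreg {x // x ∈ W} (G.comap Subtype.val)
    (by rw [hcardU]; exact hWN) (by
      intro v
      rw [hcardU]
      refine (hdeg v v.2).trans (le_of_eq ?_)
      rw [← card_neighborFinset_eq_degree, neighborFinset_eq_filter, ← card_map e]
      congr 2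
      ext x
      simp only [e, mem_filter, mem_map, mem_univ, true_and, comap_adj,
        Function.Embedding.subtype_apply, Subtype.exists, exists_and_left, exists_prop,
        exists_eq_right_right]
      tauto)
  rw [hcardU] at hcov
  have hpath : ∀ p ∈ 𝓜, ∃ l : List V, l.Nodup ∧ 4 ≤ l.length ∧
      (∀ x ∈ l, x ∈ (p.1 ∪ p.2).map e) ∧ (G.addEdges X).IsSquaredPath l ∧
      (#((p.1 ∪ p.2).map e \ l.toFinset) : ℝ) ≤ τ * #(p.1 ∪ p.2) + 6 := by
    intro p hp
    obtain ⟨hAB, hlr, s, hs, hs1, hs2, hs3, hs4⟩ := hpairs p hp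
    rw [hcardU] at hs
    have hs4' : 4 ≤ s := by
      by_contra! h
      have : 2 * M * s ≤ 2 * M * 3 := Nat.mul_le_mul_left _ (by omega)
      omega
    have hsR : (4 : ℝ) ≤ s := by exact_mod_cast hs4'
    have hτ2 : τ ≤ 1 / 4 := by rw [hτ]; linarith
    have hsW : (#W : ℝ) / (2 * M) ≤ s := by
      rw [div_le_iff₀ (by positivity)]
      have : (#W : ℝ) ≤ 2 * M * s := by exact_mod_cast hs
      linarith
    -- Largest `k` with `2 * k + τ * s ≤ s`. A pair then leaves at most `2 * τ * s + 6` vertices: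
    -- `2` from the part sizes, `4` from the floor.
    set k := ⌊s * (1 - τ) / 2⌋₊ with hk
    have hk1 : (k : ℝ) ≤ s * (1 - τ) / 2 := Nat.floor_le (by
      have : 0 ≤ 1 - τ := by linarith
      positivity)
    have hk2 : s * (1 - τ) / 2 < k + 1 := Nat.lt_floor_add_one _
    have hkpos : 1 ≤ k := by
      rw [hk, Nat.one_le_floor_iff]
      nlinarith
    have hc1 : (s : ℝ) ≤ #p.1 := by exact_mod_cast hs1
    have hc2 : (s : ℝ) ≤ #p.2 := by exact_mod_cast hs2
    have hc3 : (#p.1 : ℝ) ≤ s + 1 := by exact_mod_cast hs3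
    have hc4 : (#p.2 : ℝ) ≤ s + 1 := by exact_mod_cast hs4
    have hεs : ∀ x : ℝ, x ≤ s + 1 → ε * x ≤ d ^ 2 * (τ * s) / 2 := by
      intro x hx
      calc ε * x ≤ (d ^ 2 * τ / 4) * (2 * s) := by
            have : x ≤ 2 * s := by linarith
            have h2 : ε ≤ d ^ 2 * τ / 4 := min_le_right _ _
            calc ε * x ≤ ε * (2 * s) := by gcongr
              _ ≤ _ := by gcongr
        _ = _ := by ring
    have hABm : Disjoint (p.1.map e) (p.2.map e) := (disjoint_map e).2 hAB
    obtain ⟨l, hl1, hl2, hl3, hl4⟩ := exists_squaredPath_of_lowerRegular (μ := τ * s) hX hABm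
      hlr.map hd0 (by linarith) (by positivity)
      (by rw [card_map]; exact hεs _ hc3) (by rw [card_map]; exact hεs _ hc4)
      (hf.trans (by
        have : d ^ 2 * τ / (4 * M) * #W ≤ d ^ 2 * (τ * s) / 2 := by
          calc d ^ 2 * τ / (4 * M) * #W = d ^ 2 * (τ * (#W / (2 * M))) / 2 := by
                field_simp; ring
            _ ≤ _ := by gcongr
        calc d ^ 2 * (d ^ 2 * τ / (4 * M)) ^ 2 / 2 * (#W : ℝ) ^ 2 =
            d ^ 2 * (d ^ 2 * τ / (4 * M) * #W) ^ 2 / 2 := by ring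
          _ ≤ _ := by gcongr)) k
      (by rw [card_map]; nlinarith) (by rw [card_map]; nlinarith)
    rw [← map_union] at hl3
    refine ⟨l, hl1, by omega, hl3, hl4, ?_⟩
    have hsub : l.toFinset ⊆ (p.1 ∪ p.2).map e := fun x hx => hl3 x (List.mem_toFinset.1 hx)
    have hcl : #l.toFinset = 4 * k := by rw [List.toFinset_card_of_nodup hl1, hl2]
    have hcu : #(p.1 ∪ p.2) = #p.1 + #p.2 := card_union_of_disjoint hAB
    have h1 := card_sdiff_add_card_eq_card hsub
    rw [card_map, hcl] at h1
    have h1' : (#((p.1 ∪ p.2).map e \ l.toFinset) : ℝ) + 4 * k = #(p.1 ∪ p.2) := by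
      exact_mod_cast h1
    have hcu' : (#(p.1 ∪ p.2) : ℝ) = #p.1 + #p.2 := by exact_mod_cast hcu
    have h2 : τ * (2 * s) ≤ τ * #(p.1 ∪ p.2) := by
      gcongr
      linarith
    nlinarith
  choose! l hl1 hl2 hl3 hl4 hl5 using hpath
  have hflat : ∀ x, x ∈ (𝓜.toList.map l).flatten ↔ ∃ p ∈ 𝓜, x ∈ l p := by
    intro x
    simp only [List.mem_flatten, List.mem_map, mem_toList]
    constructor
    · rintro ⟨_, ⟨p, hp, rfl⟩, hx⟩
      exact ⟨p, hp, hx⟩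
    · rintro ⟨p, hp, hx⟩
      exact ⟨_, ⟨p, hp, rfl⟩, hx⟩
  refine ⟨𝓜.toList.map l, by rw [List.length_map, length_toList]; exact h𝓜, ?_, ?_, ?_, ?_⟩
  · intro p hp
    simp only [List.mem_map, mem_toList] at hp
    obtain ⟨q, hq, rfl⟩ := hp
    exact ⟨hl2 q hq, hl4 q hq⟩
  · rw [List.nodup_flatten]
    constructor
    · intro p hp
      simp only [List.mem_map, mem_toList] at hp
      obtain ⟨q, hq, rfl⟩ := hp
      exact hl1 q hq
    · rw [List.pairwise_map]
      refine (nodup_toList 𝓜).pairwise_of_forall_ne ?_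
      intro p hp q hq hpq x hx hx'
      rw [mem_toList] at hp hq
      have h1 := hl3 p hp x hx
      have h2 := hl3 q hq x hx'
      exact Finset.disjoint_left.1 ((disjoint_map e).2 (hdisj p hp q hq hpq)) h1 h2
  · intro x hx
    obtain ⟨p, hp, hx⟩ := (hflat x).1 hx
    obtain ⟨y, -, rfl⟩ := mem_map.1 (hl3 p hp x hx)
    exact y.2
  · have hsub : W \ (𝓜.toList.map l).flatten.toFinset ⊆
        (univ \ 𝓜.biUnion fun p => p.1 ∪ p.2).map e ∪
          𝓜.biUnion fun p => (p.1 ∪ p.2).map e \ (l p).toFinset := by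
      intro x hx
      rw [mem_sdiff, List.mem_toFinset, hflat] at hx
      obtain ⟨hxW, hx⟩ := hx
      rw [mem_union]
      by_cases h : (⟨x, hxW⟩ : {x // x ∈ W}) ∈ 𝓜.biUnion fun p => p.1 ∪ p.2
      · right
        obtain ⟨p, hp, hxp⟩ := mem_biUnion.1 h
        refine mem_biUnion.2 ⟨p, hp, mem_sdiff.2 ⟨mem_map.2 ⟨_, hxp, rfl⟩, ?_⟩⟩
        rw [List.mem_toFinset]
        exact fun h' => hx ⟨p, hp, h'⟩
      · left
        exact mem_map.2 ⟨⟨x, hxW⟩, mem_sdiff.2 ⟨mem_univ _, h⟩, rfl⟩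
    have h1 : (#(W \ (𝓜.toList.map l).flatten.toFinset) : ℝ) ≤
        #(univ \ 𝓜.biUnion fun p => p.1 ∪ p.2) +
          ∑ p ∈ 𝓜, (#((p.1 ∪ p.2).map e \ (l p).toFinset) : ℝ) := by
      have := (card_le_card hsub).trans ((card_union_le _ _).trans
        (Nat.add_le_add_left card_biUnion_le _))
      rw [card_map] at this
      exact_mod_cast this
    have h2 : ∑ p ∈ 𝓜, (#(p.1 ∪ p.2) : ℝ) ≤ #W := by
      have : #(𝓜.biUnion fun p => p.1 ∪ p.2) = ∑ p ∈ 𝓜, #(p.1 ∪ p.2) :=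
        card_biUnion fun p hp q hq hpq => hdisj p hp q hq hpq
      have h := card_le_univ (𝓜.biUnion fun p => p.1 ∪ p.2)
      rw [this, hcardU] at h
      exact_mod_cast h
    have h3 : ∑ p ∈ 𝓜, (#((p.1 ∪ p.2).map e \ (l p).toFinset) : ℝ) ≤ τ * #W + 6 * M := by
      calc _ ≤ ∑ p ∈ 𝓜, (τ * (#(p.1 ∪ p.2) : ℝ) + 6) := sum_le_sum hl5
        _ = τ * ∑ p ∈ 𝓜, (#(p.1 ∪ p.2) : ℝ) + #𝓜 * 6 := by
            rw [sum_add_distrib, ← mul_sum, sum_const, nsmul_eq_mul]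
        _ ≤ τ * #W + M * 6 := by
            gcongr
        _ = _ := by ring
    have h4 : τ * (#W : ℝ) = β / 4 * #W := by rw [hτ]
    linarith

/-- Squared paths and single vertices outside an absorbing path are joined to a cycle through the
vertices of `D`, which are then deleted from the absorbing path. -/
lemma containsHamiltonCycleSquare_of_absorbing_path {n : ℕ} {G : SimpleGraph (Fin n)}
    [DecidableRel G.Adj] {X : Finset (Sym2 (Fin n))} {f q : ℝ} (hX : HitsPopularPairs G X f)
    (hF : Flexible n q f) {D : Finset (Fin n)} {P ws : List (Fin n)} {ps : List (List (Fin n))}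
    (hP : P.Nodup) (hDP : ∀ x ∈ D, x ∈ P) (hPD : IsPiece (G.addEdges X) D P)
    (hps : ∀ p ∈ ps, 4 ≤ p.length ∧ (G.addEdges X).IsSquaredPath p) (hpsn : ps.flatten.Nodup)
    (hpsP : ∀ x ∈ ps.flatten, x ∉ P) (hws : ws.Nodup)
    (hwsm : ∀ x, x ∈ ws ↔ x ∉ P ∧ x ∉ ps.flatten)
    (hD : CommonNbrsGE G D (q + 10 * ws.length + 6 * ps.length + 6)) :
    (G.addEdges X).ContainsHamiltonCycleSquare := by
  have hF' : Flexible (Fintype.card (Fin n)) q f := by rwa [Fintype.card_fin]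
  -- Budget in `D`: four vertices per insertion, six per connector for the `ps.length + ws.length`
  -- pieces, six to close the cycle.
  obtain ⟨K₁, ss, hK₁, hK₁D, hK₁l, hssl, hssp, hss⟩ := exists_insertions (E := ∅) hX hF' ws
    (hD.mono (by
      have : (0 : ℝ) ≤ ws.length := by positivity
      have : (0 : ℝ) ≤ ps.length := by positivity
      linarith)) (fun w hw hwD => ((hwsm w).1 hw).1 (hDP w hwD)) (disjoint_empty_right _)
  obtain ⟨hdel, a, b, m, c, d, rfl, ha, hb, hc, hd⟩ := hPD
  have hcd : (G.addEdges X).IsSquaredPath [c, d] := by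
    have : (G.addEdges X).IsSquaredPath ((a :: b :: m) ++ [c, d]) := by
      simpa using hdel.isSquaredPath
    exact this.of_append_right
  have hab : (G.addEdges X).Adj a b := by
    have := hdel.isSquaredPath.adj_one (i := 0) (by simp)
    simpa using this
  have hK₁c : (#K₁.toFinset : ℝ) ≤ 4 * ws.length := by
    exact_mod_cast hK₁l ▸ List.toFinset_card_le K₁
  obtain ⟨K₂, t, hK₂, hK₂D, hK₂l, htp, htd, m', c', d', htm, -, -⟩ :=
    exists_chain (E := ∅) (m := []) (c := c) (d := d) hX hF' (ps ++ ss) (by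
      intro p hp
      rcases List.mem_append.1 hp with hp | hp
      · exact isPiece_of_length (hps p hp).2 (hps p hp).1
      · exact hss p hp) (Q := D \ K₁.toFinset)
      ((hD.sdiff K₁.toFinset).mono (by
        rw [List.length_append, hssl]
        push_cast
        linarith)) (disjoint_empty_right _) (notMem_empty _) (notMem_empty _) (by
        intro D' hD'
        rw [subset_empty.1 hD']
        simpa using hcd)
  have hts := htd.isSquaredPath
  have hcd' : (G.addEdges X).Adj c' d' := by
    rw [htm] at hts
    exact isSquaredPath_pair.1 hts.of_append_right
  have hK₂c : (#K₂.toFinset : ℝ) ≤ 6 * (ps.length + ws.length) := by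
    have := List.toFinset_card_le K₂
    rw [hK₂l, List.length_append, hssl] at this
    exact_mod_cast this
  obtain ⟨K₃, hK₃, -, hK₃D, hK₃s⟩ := exists_connector (Q := (D \ K₁.toFinset) \ K₂.toFinset) hX
    (((hD.sdiff K₁.toFinset).sdiff K₂.toFinset).mono (by linarith)) hF' hcd' hab
  -- The reservoir vertices spent on insertions and connectors; deleting them from `P` makes each
  -- vertex occur exactly once.
  set D' := (K₁ ++ K₂ ++ K₃).toFinset with hD'
  have hmemD' : ∀ x, x ∈ D' ↔ x ∈ K₁ ∨ x ∈ K₂ ∨ x ∈ K₃ := by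
    intro x
    rw [hD', List.mem_toFinset, List.mem_append, List.mem_append, or_assoc]
  have hK₂D' : ∀ x ∈ K₂, x ∈ D ∧ x ∉ K₁ := fun x hx => by
    have := mem_sdiff.1 (hK₂D x hx)
    rwa [List.mem_toFinset] at this
  have hK₃D' : ∀ x ∈ K₃, x ∈ D ∧ x ∉ K₁ ∧ x ∉ K₂ := fun x hx => by
    have := hK₃D x hx
    simp only [mem_sdiff, List.mem_toFinset] at this
    tauto
  have hD'D : D' ⊆ D := by
    intro x hx
    rcases (hmemD' x).1 hx with h | h | h
    · exact hK₁D x h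
    · exact (hK₂D' x h).1
    · exact (hK₃D' x h).1
  have hnD' : ∀ x, x ∉ D → x ∉ D' := fun x hx h => hx (hD'D h)
  set P := a :: b :: (m ++ [c, d]) with hPdef
  have hPf : P.filter (· ∉ D') = (a :: b :: m.filter (· ∉ D')) ++ [c, d] := by
    simp [hPdef, List.filter_append, hnD' a ha, hnD' b hb, hnD' c hc,
      hnD' d hd]
  have hPs := hdel D' hD'D
  rw [hPf] at hPs
  have hg1 : (G.addEdges X).IsSquaredPath ((a :: b :: m.filter (· ∉ D')) ++ c :: d :: t) :=
    hPs.glue hts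
  have hcdt : c :: d :: t = m' ++ [c', d'] := htm
  rw [hcdt, ← List.append_assoc] at hg1
  have hg2 := hg1.glue hK₃s
  set L := P.filter (· ∉ D') ++ t ++ K₃ with hL
  have hLeq : L = a :: b :: (m.filter (· ∉ D') ++ c :: d :: t ++ K₃) := by
    rw [hL, hPf]
    simp
  have hperm : L.Perm (P.filter (· ∉ D') ++ (ps.flatten ++ (ws ++ (K₁ ++ (K₂ ++ K₃))))) := by
    rw [hL, List.append_assoc]
    refine List.Perm.append_left _ ?_
    refine (htp.append_right K₃).trans ?_
    rw [List.flatten_append]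
    refine ((hssp.append_left ps.flatten).append_left K₂ |>.append_right K₃).trans ?_
    rw [← Multiset.coe_eq_coe]
    simp only [← Multiset.coe_add]
    abel
  have hnd : L.Nodup := by
    rw [hperm.nodup_iff]
    simp only [List.nodup_append']
    refine ⟨hP.filter _, ⟨hpsn, ⟨hws, ⟨hK₁, ⟨hK₂, hK₃, ?_⟩, ?_⟩, ?_⟩, ?_⟩, ?_⟩
    · exact fun x hx hx' => (hK₃D' x hx').2.2 hx
    · intro x hx hx'
      rcases List.mem_append.1 hx' with h | h
      · exact (hK₂D' x h).2 hx
      · exact (hK₃D' x h).2.1 hx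
    · intro x hx hx'
      have hxD : x ∈ D' := by
        rw [hmemD']
        simpa using hx'
      exact ((hwsm x).1 hx).1 (hDP x (hD'D hxD))
    · intro x hx hx'
      rcases List.mem_append.1 hx' with h | h
      · exact ((hwsm x).1 h).2 hx
      · have hxD : x ∈ D' := by
          rw [hmemD']
          simpa using h
        exact hpsP x hx (hDP x (hD'D hxD))
    · intro x hx hx'
      have h1 : x ∈ P ∧ x ∉ D' := by simpa using List.mem_filter.1 hx
      rcases List.mem_append.1 hx' with h | h
      · exact hpsP x h h1.1
      rcases List.mem_append.1 h with h | h
      · exact ((hwsm x).1 h).1 h1.1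
      · have hxD : x ∈ D' := by
          rw [hmemD']
          simpa using h
        exact h1.2 hxD
  have hmem : ∀ x, x ∈ L := by
    intro x
    rw [hperm.mem_iff]
    simp only [List.mem_append]
    by_cases hxP : x ∈ P
    · by_cases hxD : x ∈ D'
      · have := (hmemD' x).1 hxD
        tauto
      · exact Or.inl (List.mem_filter.2 ⟨hxP, by simpa using hxD⟩)
    · have := hwsm x
      tauto
  have hlen : L.length = n := by
    rw [← List.toFinset_card_of_nodup hnd]
    have : L.toFinset = univ := by
      ext x
      simp [hmem x]
    rw [this, card_univ, Fintype.card_fin]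
  rw [hLeq] at hnd hlen
  refine containsHamiltonCycleSquare_of_list hnd hlen ?_
  have he : a :: b :: (m.filter (· ∉ D') ++ c :: d :: t ++ K₃) ++ [a, b] =
      (a :: b :: m.filter (· ∉ D')) ++ m' ++ c' :: d' :: (K₃ ++ [a, b]) := by
    rw [hcdt]
    simp
  rw [he]
  exact hg2

end

/-! ### Choice of constants and conclusion. -/

section
open Finset SimpleGraph

set_option maxHeartbeats 1000000 in
/-- Above minimum degree `n / 2`, any `X` hitting all quadratically large sets of popular pairs
completes `G` to a graph containing the square of a Hamilton cycle. -/
lemma exists_forall_containsHamiltonCycleSquare_of_hits {γ : ℝ} (hγ : 0 < γ) (hγ1 : γ ≤ 1 / 2) :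
    ∃ (c : ℝ) (N : ℕ), 0 < c ∧ ∀ n : ℕ, N ≤ n → ∀ (G : SimpleGraph (Fin n))
      [DecidableRel G.Adj], (∀ v, (1 / 2 + γ) * n ≤ G.degree v) → ∀ X : Finset (Sym2 (Fin n)),
      HitsPopularPairs G X (c * (n : ℝ) ^ 2) →
        (G.addEdges X).ContainsHamiltonCycleSquare := by
  set g := 2 * γ with hg
  -- `11 * δ ≤ γ / 2`, so removing the absorbing path leaves half of the degree surplus.
  set δ := γ / 24 with hδ
  have hg0 : 0 < g := by positivity
  have hδ0 : 0 < δ := by positivity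
  -- The reservoir codegree `g * T / 8` is split in half. One half covers `κ * n`; the other, at
  -- least `g * δ * n / 32`, pays equally for `10 * β * n` and for `6 * M + 6`.
  set β := g * δ / 640 with hβ
  have hβ0 : 0 < β := by positivity
  have hβ1 : β ≤ 1 := by
    have : g * δ ≤ 1 * 1 := mul_le_mul (by linarith) (by linarith) hδ0.le one_pos.le
    linarith
  obtain ⟨M, N₁, c₁, hc₁, hcover⟩ := exists_squaredPath_cover (γ := γ / 2) (β := β)
    (by positivity) (by linarith) hβ0 hβ1
  set κ := g * δ / 32 with hκ
  have hκ0 : 0 < κ := by positivity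
  -- The first term serves `Flexible`; the second serves the path cover, where `#W ≥ n / 2`.
  set c := min (κ ^ 8 / 32) (c₁ / 8) with hc
  have hc0 : 0 < c := by positivity
  set A : ℝ := 1 + 2 / δ + 6 * (16 / (g * δ)) ^ 3 + (6 * M + 6) * 64 / (g * δ) + 8 / κ ^ 4 +
    32 / κ ^ 8 + 8 / c₁ + 2 * N₁ with hA
  refine ⟨c, ⌈A⌉₊, hc0, fun n hn G _ hdeg X hX => ?_⟩
  have hnA : A ≤ n := (Nat.le_ceil A).trans (by exact_mod_cast hn)
  have p1 : 0 < 2 / δ := by positivity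
  have p2 : 0 < 6 * (16 / (g * δ)) ^ 3 := by positivity
  have p3 : 0 < (6 * (M : ℝ) + 6) * 64 / (g * δ) := by positivity
  have p4 : 0 < 8 / κ ^ 4 := by positivity
  have p5 : 0 < 32 / κ ^ 8 := by positivity
  have p6 : 0 < 8 / c₁ := by positivity
  have p7 : (0 : ℝ) ≤ 2 * N₁ := by positivity
  have hn1 : (1 : ℝ) ≤ n := by linarith
  have hn0 : (0 : ℝ) < n := by linarith
  have q1 : 2 ≤ δ * n := by
    have : 2 / δ ≤ n := by linarith
    rwa [div_le_iff₀' hδ0] at this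
  have q2 : (n : ℝ) ^ 2 ≤ Real.exp (g * δ * n / 16) := by
    have h1 : 6 * (16 / (g * δ)) ^ 3 ≤ n := by linarith
    have h2 := Real.pow_div_factorial_le_exp (g * δ * n / 16) (by positivity) 3
    refine le_trans ?_ h2
    have h3 : (6 : ℝ) ≤ (g * δ / 16) ^ 3 * n := by
      calc (6 : ℝ) = (g * δ / 16) ^ 3 * (6 * (16 / (g * δ)) ^ 3) := by field_simp
        _ ≤ _ := by gcongr
    rw [le_div_iff₀ (by positivity)]
    calc (n : ℝ) ^ 2 * (Nat.factorial 3 : ℕ) = n ^ 2 * 6 := by norm_num [Nat.factorial]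
      _ ≤ n ^ 2 * ((g * δ / 16) ^ 3 * n) := by gcongr
      _ = _ := by ring
  have q3 : 6 * (M : ℝ) + 6 ≤ g * δ * n / 64 := by
    have : (6 * (M : ℝ) + 6) * 64 / (g * δ) ≤ n := by linarith
    rw [div_le_iff₀' (by positivity)] at this
    linarith
  have q4 : 8 ≤ κ ^ 4 * n := by
    have : 8 / κ ^ 4 ≤ n := by linarith
    rwa [div_le_iff₀' (by positivity)] at this
  have q5 : 32 ≤ κ ^ 8 * n := by
    have : 32 / κ ^ 8 ≤ n := by linarith
    rwa [div_le_iff₀' (by positivity)] at this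
  have q6 : 8 ≤ c₁ * n := by
    have : 8 / c₁ ≤ n := by linarith
    rwa [div_le_iff₀' (by positivity)] at this
  have q7 : 2 * (N₁ : ℝ) ≤ n := by linarith
  have hcardV : Fintype.card (Fin n) = n := Fintype.card_fin n
  set T := ⌊δ * n⌋₊ with hT
  have hT1 : (T : ℝ) ≤ δ * n := Nat.floor_le (by positivity)
  have hT2 : δ * n / 2 ≤ T := by
    have := Nat.lt_floor_add_one (δ * n)
    linarith
  have hγn : 0 ≤ γ * n := by positivity
  have hδγ : 11 * (δ * n) ≤ γ / 2 * n := by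
    rw [hδ]
    linarith
  have hG : CommonNbrsGE G univ (g * n) := by
    intro x y
    have h1 : commonNbrs G x y univ = G.neighborFinset x ∩ G.neighborFinset y := by
      ext z
      simp [mem_commonNbrs]
    have h2 := card_union_add_card_inter (G.neighborFinset x) (G.neighborFinset y)
    rw [← h1, card_neighborFinset_eq_degree, card_neighborFinset_eq_degree] at h2
    have h3 : #(G.neighborFinset x ∪ G.neighborFinset y) ≤ n :=
      (card_le_univ _).trans hcardV.le
    have h4 : (G.degree x : ℝ) + G.degree y ≤ n + #(commonNbrs G x y univ) := by
      exact_mod_cast h2.symm.le.trans (Nat.add_le_add_right h3 _)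
    have := hdeg x
    have := hdeg y
    rw [hg]
    linarith
  have hgT : g * (δ * n / 2) ≤ g * T := by gcongr
  obtain ⟨D, hD, hDc⟩ := exists_reservoir (g := g) hg0 (by linarith)
    (by rw [hcardV]; exact hG) T (by rw [hcardV, hg]; linarith) (by
      rw [hcardV]
      refine q2.trans (Real.exp_le_exp.2 ?_)
      linarith)
  set f := c * (n : ℝ) ^ 2 with hf
  have hF : Flexible n (κ * n) f := by
    have e : (κ * n) ^ 4 / (2 * (n : ℝ) ^ 3) = κ ^ 4 * n / 2 := by
      field_simp
    refine ⟨hn0, by positivity, ?_, ?_⟩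
    · rw [e]
      linarith
    · rw [e]
      have h1 : f ≤ κ ^ 8 / 32 * (n : ℝ) ^ 2 := by
        rw [hf]
        gcongr
        exact min_le_left _ _
      have h2 : 32 * (n : ℝ) ≤ κ ^ 8 * (n : ℝ) ^ 2 := by
        calc 32 * (n : ℝ) ≤ κ ^ 8 * n * n := by gcongr
          _ = _ := by ring
      have h3 : (κ ^ 4 * n / 2) ^ 2 / 4 = κ ^ 8 * (n : ℝ) ^ 2 / 16 := by ring
      rw [h3]
      linarith
  have hκT : κ * n ≤ g * T / 16 := by
    rw [hκ]
    linarith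
  have hDne : D.Nonempty := by
    rw [← card_pos, hD]
    have : (0 : ℝ) < T := by linarith
    exact_mod_cast this
  obtain ⟨P, hP, hPl, hDP, hPD⟩ := exists_absorbing_path hX (by rw [hcardV]; exact hF) hG hDne (by
    rw [hD]
    have h1 : g * T ≤ T := mul_le_of_le_one_left (by positivity) (by linarith)
    have h2 : g * n = 2 * (γ * n) := by rw [hg]; ring
    linarith)
  rw [hD] at hPl
  have hPlR : (P.length : ℝ) ≤ γ / 2 * n := by
    have : (P.length : ℝ) ≤ 11 * T := by exact_mod_cast hPl
    linarith
  set W := univ \ P.toFinset with hW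
  have hWcard : #W + P.length = n := by
    rw [hW, ← List.toFinset_card_of_nodup hP, card_sdiff_add_card_eq_card (subset_univ _),
      card_univ, hcardV]
  have hWR : (#W : ℝ) + P.length = n := by exact_mod_cast hWcard
  have hWn : (n : ℝ) / 2 ≤ #W := by
    have : γ / 2 * n ≤ 1 / 4 * n :=
      mul_le_mul_of_nonneg_right (by linarith) hn0.le
    linarith
  have hWle : (#W : ℝ) ≤ n := by
    have : (0 : ℝ) ≤ P.length := by positivity
    linarith
  obtain ⟨ps, hpsM, hps, hpsn, hpsW, hleft⟩ := hcover (Fin n) G X f W (by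
      have : (N₁ : ℝ) ≤ #W := by linarith
      exact_mod_cast this) (by
      intro v _
      have h1 : G.neighborFinset v ⊆ W.filter (G.Adj v) ∪ P.toFinset := by
        intro x hx
        rw [mem_neighborFinset] at hx
        rw [mem_union, mem_filter, hW, mem_sdiff]
        by_cases h : x ∈ P.toFinset
        · exact Or.inr h
        · exact Or.inl ⟨⟨mem_univ _, h⟩, hx⟩
      have h2 := (card_le_card h1).trans (card_union_le _ _)
      rw [card_neighborFinset_eq_degree, List.toFinset_card_of_nodup hP] at h2
      have h3 : (G.degree v : ℝ) ≤ #(W.filter (G.Adj v)) + P.length := by exact_mod_cast h2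
      have h4 := hdeg v
      have h5 : (1 / 2 + γ / 2) * (#W : ℝ) ≤ (1 / 2 + γ / 2) * n := by gcongr
      linarith) hX (by
      rw [hcardV]
      have h1 : f ≤ c₁ / 8 * (n : ℝ) ^ 2 := by
        rw [hf]
        gcongr
        exact min_le_right _ _
      have h2 : 8 * (n : ℝ) ≤ c₁ * (n : ℝ) ^ 2 := by
        calc 8 * (n : ℝ) ≤ c₁ * n * n := by gcongr
          _ = _ := by ring
      have h3 : c₁ * ((n : ℝ) / 2) ^ 2 ≤ c₁ * (#W : ℝ) ^ 2 := by gcongr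
      have h4 : c₁ * ((n : ℝ) / 2) ^ 2 = c₁ * (n : ℝ) ^ 2 / 4 := by ring
      linarith)
  set ws := (W \ ps.flatten.toFinset).toList with hws
  have hwsl : (ws.length : ℝ) ≤ β * n := by
    rw [hws, length_toList]
    refine hleft.trans ?_
    gcongr
  refine containsHamiltonCycleSquare_of_absorbing_path hX hF hP hDP hPD hps hpsn ?_
    (nodup_toList _) ?_ (hDc.mono ?_) (ws := ws)
  · intro x hx hxP
    have := hpsW x hx
    rw [hW, mem_sdiff, List.mem_toFinset] at this
    exact this.2 hxP
  · intro x
    rw [hws, mem_toList, mem_sdiff, hW, mem_sdiff, List.mem_toFinset, List.mem_toFinset]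
    simp only [mem_univ, true_and]
  · have h1 : (ps.length : ℝ) ≤ M := by exact_mod_cast hpsM
    have h2 : 10 * (β * n) = g * δ * n / 64 := by rw [hβ]; ring
    have h3 : g * δ * n / 32 ≤ g * T / 16 := by linarith
    linarith

/-- The assumed number of edges beats any linear bound: `n ^ (1/3) ≥ A`, and the logarithmic factor
is at least `1` from `n = 3` on. -/
lemma mul_le_rpow_mul_log_rpow {A : ℝ} (hA : 0 ≤ A) {n : ℕ} (hn : 3 ≤ n) (hAn : A ^ 3 ≤ n) :
    A * n ≤ 1 * (n : ℝ) ^ (4 / 3 : ℝ) * (Real.log n) ^ (1 / 3 : ℝ) := by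
  have hn3 : (3 : ℝ) ≤ n := by exact_mod_cast hn
  have hn0 : (0 : ℝ) < n := by linarith
  have hlog : 1 ≤ Real.log n := by
    rw [Real.le_log_iff_exp_le hn0]
    have := Real.exp_one_lt_d9
    linarith
  have h1 : 1 ≤ (Real.log n) ^ (1 / 3 : ℝ) := Real.one_le_rpow hlog (by norm_num)
  have h2 : A ≤ (n : ℝ) ^ (1 / 3 : ℝ) := by
    calc A = (A ^ 3) ^ (1 / 3 : ℝ) := by
          rw [← Real.rpow_natCast, ← Real.rpow_mul hA]
          norm_num
      _ ≤ _ := by gcongr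
  have h3 : (n : ℝ) ^ (4 / 3 : ℝ) = n ^ (1 / 3 : ℝ) * n := by
    rw [show (4 / 3 : ℝ) = 1 / 3 + 1 by norm_num, Real.rpow_add hn0, Real.rpow_one]
  rw [one_mul, h3]
  calc A * n ≤ (n : ℝ) ^ (1 / 3 : ℝ) * n := by gcongr
    _ ≤ _ := le_mul_of_one_le_right (by positivity) h1

end

theorem theorem1 (α : ℝ) (hα : 1 / 2 < α) :
    ∃ K : ℝ, 0 < K ∧
      ∀ ε : ℝ, 0 < ε → ∃ N : ℕ, ∀ n : ℕ, N ≤ n →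
        ∀ (G : SimpleGraph (Fin n)) [DecidableRel G.Adj], α * (n : ℝ) ≤ (G.minDegree : ℝ) →
          ∀ m : ℕ, m ≤ n.choose 2 →
            K * (n : ℝ) ^ (4 / 3 : ℝ) * (Real.log (n : ℝ)) ^ (1 / 3 : ℝ) ≤ (m : ℝ) →
              1 - ε ≤ probRandomEdges n m
                (fun X => (G.addEdges X).ContainsHamiltonCycleSquare) := by
  -- Capping `α` at `1` keeps `γ ≤ 1 / 2`.
  obtain ⟨c, N, hc, hN⟩ := exists_forall_containsHamiltonCycleSquare_of_hits
    (γ := min α 1 - 1 / 2) (by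
      have : 1 / 2 < min α 1 := lt_min hα (by norm_num)
      linarith) (by linarith [min_le_right α 1])
  -- The dependence on `ε` goes entirely into the threshold for `n`.
  refine ⟨1, one_pos, fun ε hε => ?_⟩
  set A := (4 + 1 / ε) / c with hA
  have hA0 : 0 ≤ A := by positivity
  refine ⟨max N (max 3 ⌈A ^ 3⌉₊), fun n hn G _ hdeg m hm hK => ?_⟩
  have hnN : N ≤ n := (le_max_left _ _).trans hn
  have hn3 : 3 ≤ n := (le_max_left _ _).trans ((le_max_right _ _).trans hn)
  have hnA : A ^ 3 ≤ n := (Nat.le_ceil _).trans (by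
    exact_mod_cast (le_max_right _ _).trans ((le_max_right _ _).trans hn))
  refine le_probRandomEdges_of_hitsPopularPairs hc hε (by omega) G hm
    ((mul_le_rpow_mul_log_rpow hA0 hn3 hnA).trans hK) _ fun X hX => ?_
  refine hN n hnN G (fun v => ?_) X hX
  have h1 : (G.minDegree : ℝ) ≤ G.degree v := by exact_mod_cast G.minDegree_le_degree v
  have h2 : min α 1 * n ≤ α * n := by
    gcongr
    exact min_le_left _ _
  linarith
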